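/- Let $(D,S)$ be a Dyer system: $S=\{s_1,\dots,s_n\}$ is finite and $$D=\langle s_1,\dots,s_n \mid s_i^{f_i}=1\ (1\le i\le n),\ [s_i,s_j]_{m_{ij}}=[s_j,s_i]_{m_{ij}}\ (i\ne j)\rangle,$$ where $[a,b]_k=aba\cdots$ ($k$ factors), $f_i,\,m_{ij}=m_{ji}\in\{2,3,\dots\}\cup\{\infty\}$, relations with exponent $\infty$ are omitted, and $m_{ij}\in\{2,\infty\}$ whenever $i\neq j$ and $f_i\ge 3$ or $f_j\ge 3$. Its Dyer graph has vertices $v_1,\dots,v_n$, with an edge between distinct $v_i$ and $v_j$ if and only if $m_{ij}\ge 3$. Let $b(m)$ be the number of elements of $D$ of word length at most $m$ with respect to $S\cup S^{-1}$. Let $S_2=\{s_i : f_i=2\}$ and $D_2=\langle S_2\rangle\le D$. A Coxeter system $(W,T)$ is called spherical if, for some $d \ge 0$, $W$ acts properly discontinuously by isometries on the sphere $\mathbb S^d$ with the elements of $T$ acting as reflections; it is called Euclidean if $W$ is infinite and, for some $d \ge 0$, acts properly discontinuously by isometries on $\mathbb E^d$ with the elements of $T$ acting as reflections. The Dyer system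 $(D,S)$ is called spherical (respectively Euclidean) if no vertex $v_i$ with $f_i\ge3$ is an endpoint of an edge of the Dyer graph, and the Coxeter system $(D_2,S_2)$ is spherical (respectively Euclidean). Then the limit $\tau(D,S)=\lim_{m\to\infty}\sqrt[m]{b(m)}$ exists, and $\tau(D,S)=1$ if and only if $(D,S)$ is spherical or Euclidean. -/

import Mathlib

open Filter Topology

noncomputable section

/-! Growth of groups with a marking -/

/-- The ball of radius `m` about `1` for the word metric of the family `s`: the elements that are
products of at most `m` factors from `S ∪ S⁻¹`, that is, the elements of word length at most `m`. -/
def wordBall {ι G : Type*} [Group G] (s : ι → G) (m : ℕ) : Set G :=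
  {x | ∃ l : List G, l.length ≤ m ∧ (∀ g ∈ l, ∃ i, g = s i ∨ g = (s i)⁻¹) ∧ l.prod = x}

/-- The growth function `b(m)`. -/
def growthFunction {ι G : Type*} [Group G] (s : ι → G) (m : ℕ) : ℕ := (wordBall s m).ncard

/-- The sequence of `m`-th roots of the growth function. -/
def growthRoot {ι G : Type*} [Group G] (s : ι → G) (m : ℕ) : ℝ :=
  (growthFunction s m : ℝ) ^ ((m : ℝ)⁻¹)

/-- The growth rate `τ(G, S)`, the limit of the `m`-th roots of `b(m)`. -/
def growthRate {ι G : Type*} [Group G] (s : ι → G) : ℝ := limUnder atTop (growthRoot s)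

/-! Spherical and Euclidean reflection actions -/

/-- An action by isometries is properly discontinuous if, for all compact `K`, `L`, only finitely
many group elements move `K` to a set meeting `L`. -/
def IsProperlyDiscontinuousAction {W X : Type*} [Group W] [MetricSpace X] (ρ : W →* (X ≃ᵢ X)) :
    Prop :=
  ∀ K L : Set X, IsCompact K → IsCompact L → {w : W | ((ρ w '' K) ∩ L).Nonempty}.Finite

/-- Euclidean space `𝔼^d`. -/
abbrev EucSpace (d : ℕ) : Type := EuclideanSpace ℝ (Fin d)

/-- The unit sphere `𝕊^d` in `ℝ^(d+1)`; the chordal and the angular metric have the same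
isometries and the same compact sets. -/
abbrev UnitSphere (d : ℕ) : Type := Metric.sphere (0 : EuclideanSpace ℝ (Fin (d + 1))) 1

/-- `g` is the reflection of `𝕊^d` in the linear hyperplane orthogonal to a nonzero vector. -/
def IsSphereReflection {d : ℕ} (g : UnitSphere d ≃ᵢ UnitSphere d) : Prop :=
  ∃ v : EuclideanSpace ℝ (Fin (d + 1)), v ≠ 0 ∧
    ∀ x : UnitSphere d, (g x : EuclideanSpace ℝ (Fin (d + 1))) =
      (Submodule.span ℝ {v})ᗮ.reflection (x : EuclideanSpace ℝ (Fin (d + 1)))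

/-- `g` is the reflection of `𝔼^d` in the affine hyperplane through some `p` orthogonal to a
nonzero vector `v`. -/
def IsEuclideanReflection {d : ℕ} (g : EucSpace d ≃ᵢ EucSpace d) : Prop :=
  ∃ v p : EucSpace d, v ≠ 0 ∧
    ∀ x : EucSpace d, g x = p + (Submodule.span ℝ {v})ᗮ.reflection (x - p)

/-- The Coxeter system `(W, S)`, `S` the family `t`, is spherical: `W` acts properly
discontinuously by isometries on some `𝕊^d`, the elements of `S` acting as reflections. -/
def IsSphericalCoxeter {ι W : Type*} [Group W] (t : ι → W) : Prop :=
  ∃ (d : ℕ) (ρ : W →* (UnitSphere d ≃ᵢ UnitSphere d)),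
    IsProperlyDiscontinuousAction ρ ∧ ∀ i, IsSphereReflection (ρ (t i))

/-- The Coxeter system `(W, S)`, `S` the family `t`, is Euclidean: `W` is infinite and acts
properly discontinuously by isometries on some `𝔼^d`, the elements of `S` acting as reflections. -/
def IsEuclideanCoxeter {ι W : Type*} [Group W] (t : ι → W) : Prop :=
  Infinite W ∧ ∃ (d : ℕ) (ρ : W →* (EucSpace d ≃ᵢ EucSpace d)),
    IsProperlyDiscontinuousAction ρ ∧ ∀ i, IsEuclideanReflection (ρ (t i))

/-! Dyer systems -/

/-- The alternating product `[a, b]_k = a b a ⋯` with `k` factors. -/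
def altProd {G : Type*} [Group G] (a b : G) : ℕ → G
  | 0 => 1
  | k + 1 => a * altProd b a k

/-- A Dyer matrix: the diagonal entry at `v` is the order `f_v` of the generator, the entry at
`u ≠ v` is the braid exponent `m_{uv}`. -/
structure DyerMatrix (V : Type*) where
  /-- the entries -/
  entry : V → V → ℕ∞
  symm : ∀ u v, entry u v = entry v u
  two_le : ∀ u v, 2 ≤ entry u v
  eq_two_or_top : ∀ u v, u ≠ v → 3 ≤ entry u u → entry u v = 2 ∨ entry u v = ⊤

namespace DyerMatrix

variable {V : Type*} (M : DyerMatrix V)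

/-- The underlying simple graph of the associated Dyer graph: distinct vertices `u`, `v` are joined
by an edge if `m_{uv} ≥ 3`. -/
def graph : SimpleGraph V where
  Adj u v := u ≠ v ∧ 3 ≤ M.entry u v
  symm := ⟨fun u v h => ⟨h.1.symm, by rw [M.symm]; exact h.2⟩⟩
  loopless := ⟨fun _ h => h.1 rfl⟩

/-- The relators `s_v ^ f_v` and `[s_u, s_v]_m [s_v, s_u]_m ⁻¹`, omitted for infinite exponents. -/
def relators : Set (FreeGroup V) :=
  {r | ∃ (v : V) (k : ℕ), M.entry v v = (k : ℕ∞) ∧ r = FreeGroup.of v ^ k} ∪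
  {r | ∃ (u v : V) (k : ℕ), u ≠ v ∧ M.entry u v = (k : ℕ∞) ∧
    r = altProd (FreeGroup.of u) (FreeGroup.of v) k *
      (altProd (FreeGroup.of v) (FreeGroup.of u) k)⁻¹}

end DyerMatrix

/-- A Dyer system `(D, S)` with Dyer matrix `M`: a group `D` with an isomorphism to the group
presented by the generators `V` and the relators of `M`. -/
structure DyerSystem {V : Type*} (M : DyerMatrix V) (D : Type*) [Group D] where
  /-- the isomorphism with the presented group -/
  mulEquiv : D ≃* PresentedGroup M.relators

namespace DyerSystem

variable {V : Type*} {M : DyerMatrix V} {D : Type*} [Group D] (ds : DyerSystem M D)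

/-- The Dyer generating family `S = (s_v)`. -/
def gen (v : V) : D := ds.mulEquiv.symm (PresentedGroup.of v)

/-- The subgroup `D_2` generated by the set `S_2` of the generators with `f_v = 2`. -/
def involutionSubgroup : Subgroup D := Subgroup.closure (ds.gen '' {v | M.entry v v = 2})

/-- The generating family `S_2` of `D_2`. -/
def involutionGen (v : {v : V // M.entry v v = 2}) : ds.involutionSubgroup :=
  ⟨ds.gen v, Subgroup.subset_closure ⟨v, v.2, rfl⟩⟩

/-- `(D, S)` is spherical: the vertices with `f_v ≥ 3` carry no edges of the Dyer graph, and the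
Coxeter system `(D_2, S_2)` is spherical. -/
def IsSpherical : Prop :=
  (∀ u v, 3 ≤ M.entry u u → ¬ M.graph.Adj u v) ∧ IsSphericalCoxeter ds.involutionGen

/-- `(D, S)` is Euclidean: the vertices with `f_v ≥ 3` carry no edges of the Dyer graph, and the
Coxeter system `(D_2, S_2)` is Euclidean. -/
def IsEuclidean : Prop :=
  (∀ u v, 3 ≤ M.entry u u → ¬ M.graph.Adj u v) ∧ IsEuclideanCoxeter ds.involutionGen

end DyerSystem

end

/-! ### Word balls and growth -/

section Growth

variable {ι G : Type*} [Group G] {s : ι → G}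

/-! The limit exists by Fekete's lemma. If `(D, S)` is spherical or Euclidean, the generators of
order at least 3 are central, so up to a polynomial factor the growth is that of `D_2`
(`growthFunction_le_of_not_adj`). In the spherical case `D_2` is finite. In the Euclidean case an
orbit in `𝔼^d` has boundedly many group elements per grid cell and spreads at most linearly with
word length (`growthFunction_le_of_isEuclideanCoxeter`). Growth is thus polynomial and the rate is
1.

Conversely, enlarge `D` by a reflection inverting each generator of order at least 3. Every such
generator becomes a product of two reflections, and the cosine matrix `extGram` governs the
resulting linear reflection group. That group grows no faster than `D` up to a constant factor
(`growthFunction_reflection_le`). If the matrix is not positive semidefinite, a minimal indefinite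
principal submatrix gives a form of signature `(n - 1, 1)` with `n ≥ 3`. Its roots accumulate
projectively at isotropic directions that span the space, so three roots can be found with pairwise
products at most `-1` (`exists_three_roots`). Ping-pong with their reflections gives a free
semigroup (`exists_free_semigroup`), hence exponential growth.

So growth rate 1 makes `extGram` positive semidefinite. A test vector then excludes edges at
vertices of order at least 3 (`not_adj_of_growthRate_eq_one`), and the block belonging to `D_2` is
the Gram matrix of unit vectors `a i` in a Euclidean space. If `D_2` is finite, the linear
reflections in the `a i` act on a sphere. If it is infinite, the reflections in the affine walls `⟪a
i, x⟫ + 1 = 0` are used. Tits' argument (`exists_apply_neg`) shows that every `w ≠ 1` carries the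
origin across one of these walls, so the orbit is 1-separated and the action is properly
discontinuous. -/

theorem one_mem_wordBall (m : ℕ) : (1 : G) ∈ wordBall s m := ⟨[], by simp, by simp, rfl⟩

theorem wordBall_mono {m n : ℕ} (h : m ≤ n) : wordBall s m ⊆ wordBall s n := by
  rintro x ⟨l, hl, hg, rfl⟩
  exact ⟨l, hl.trans h, hg, rfl⟩

theorem mul_mem_wordBall {m n : ℕ} {x y : G} (hx : x ∈ wordBall s m) (hy : y ∈ wordBall s n) :
    x * y ∈ wordBall s (m + n) := by
  obtain ⟨l, hl, hg, rfl⟩ := hx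
  obtain ⟨l', hl', hg', rfl⟩ := hy
  refine ⟨l ++ l', by simp; omega, fun g h => ?_, by simp⟩
  rcases List.mem_append.1 h with h | h
  exacts [hg g h, hg' g h]

theorem gen_mem_wordBall (i : ι) : s i ∈ wordBall s 1 :=
  ⟨[s i], by simp, by simpa using ⟨i, Or.inl rfl⟩, by simp⟩

theorem gen_inv_mem_wordBall (i : ι) : (s i)⁻¹ ∈ wordBall s 1 :=
  ⟨[(s i)⁻¹], by simp, by simpa using ⟨i, Or.inr rfl⟩, by simp⟩

theorem wordBall_induction {P : ℕ → G → Prop} (one : ∀ m, P m 1)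
    (gen : ∀ m i x, P m x → P (m + 1) (s i * x))
    (inv : ∀ m i x, P m x → P (m + 1) ((s i)⁻¹ * x)) {m : ℕ} {x : G} (hx : x ∈ wordBall s m) :
    P m x := by
  obtain ⟨l, hl, hg, rfl⟩ := hx
  induction l generalizing m with
  | nil => exact one m
  | cons a l ih =>
    obtain ⟨m, rfl⟩ : ∃ k, m = k + 1 := ⟨m - 1, by simp at hl; omega⟩
    have := ih (m := m) (by simpa using hl) fun g h => hg g (by simp [h])
    obtain ⟨i, rfl | rfl⟩ := hg a (by simp)
    · simpa using gen m i _ this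
    · simpa using inv m i _ this

theorem exists_mul_of_mem_wordBall {m n : ℕ} {x : G} (hx : x ∈ wordBall s (m + n)) :
    ∃ y ∈ wordBall s m, ∃ z ∈ wordBall s n, y * z = x := by
  obtain ⟨l, hl, hg, rfl⟩ := hx
  refine ⟨(l.take m).prod, ⟨_, by simp, fun g h => hg g (List.mem_of_mem_take h), rfl⟩,
    (l.drop m).prod, ⟨_, by simp; omega, fun g h => hg g (List.mem_of_mem_drop h), rfl⟩,
    by rw [← List.prod_append, List.take_append_drop]⟩

theorem exists_mem_wordBall {x : G} (hx : x ∈ Subgroup.closure (Set.range s)) :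
    ∃ m, x ∈ wordBall s m := by
  induction hx using Subgroup.closure_induction_left with
  | one => exact ⟨0, one_mem_wordBall 0⟩
  | mul_left g hg y _ ih =>
    obtain ⟨i, rfl⟩ := hg
    obtain ⟨m, hm⟩ := ih
    exact ⟨_, mul_mem_wordBall (gen_mem_wordBall i) hm⟩
  | inv_mul_cancel g hg y _ ih =>
    obtain ⟨i, rfl⟩ := hg
    obtain ⟨m, hm⟩ := ih
    exact ⟨_, mul_mem_wordBall (gen_inv_mem_wordBall i) hm⟩

variable [Finite ι]

theorem finite_wordBall (s : ι → G) (m : ℕ) : (wordBall s m).Finite := by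
  induction m with
  | zero =>
    refine (Set.finite_singleton (1 : G)).subset ?_
    rintro x ⟨l, hl, -, rfl⟩
    simp [List.length_eq_zero_iff.1 (Nat.le_zero.1 hl)]
  | succ m ih =>
    have hfin : (Set.range s ∪ Set.range (fun i => (s i)⁻¹) ∪ {1}).Finite :=
      ((Set.finite_range _).union (Set.finite_range _)).union (Set.finite_singleton _)
    refine (Set.Finite.image2 (· * ·) hfin ih).subset fun x hx => ?_
    rw [add_comm] at hx
    obtain ⟨y, hy, z, hz, rfl⟩ := exists_mul_of_mem_wordBall hx
    refine ⟨y, ?_, z, hz, rfl⟩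
    obtain ⟨l, hl, hg, rfl⟩ := hy
    match l, hl, hg with
    | [], _, _ => simp
    | [a], _, hg =>
      obtain ⟨i, h | h⟩ := hg a (by simp)
      · exact Or.inl (Or.inl ⟨i, by simp [h]⟩)
      · exact Or.inl (Or.inr ⟨i, by simp [h]⟩)

theorem growthFunction_pos (s : ι → G) (m : ℕ) : 0 < growthFunction s m :=
  (Set.ncard_pos (finite_wordBall s m)).2 ⟨1, one_mem_wordBall m⟩

theorem growthFunction_add_le (s : ι → G) (m n : ℕ) :
    growthFunction s (m + n) ≤ growthFunction s m * growthFunction s n := by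
  unfold growthFunction
  rw [← Set.ncard_prod]
  have hfin := (finite_wordBall s m).prod (finite_wordBall s n)
  refine (Set.ncard_le_ncard (t := (fun p : G × G => p.1 * p.2) '' (wordBall s m ×ˢ wordBall s n))
    (fun x hx => ?_) (hfin.image _)).trans (Set.ncard_image_le hfin)
  obtain ⟨y, hy, z, hz, rfl⟩ := exists_mul_of_mem_wordBall hx
  exact ⟨(y, z), ⟨hy, hz⟩, rfl⟩

/-- Submultiplicativity of the growth function makes its logarithm subadditive, so Fekete's lemma
applies. -/
theorem exists_tendsto_log_growthFunction (s : ι → G) :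
    ∃ L : ℝ, Tendsto (fun m : ℕ => Real.log (growthFunction s m) / m) atTop (𝓝 L) := by
  have hsub : Subadditive fun m => Real.log (growthFunction s m) := fun m n => by
    have hm := growthFunction_pos s m
    have hn := growthFunction_pos s n
    rw [← Real.log_mul (by positivity) (by positivity)]
    have := growthFunction_pos s (m + n)
    exact Real.log_le_log (by positivity) (by exact_mod_cast growthFunction_add_le s m n)
  refine ⟨_, hsub.tendsto_lim ⟨0, ?_⟩⟩
  rintro _ ⟨m, rfl⟩
  have hm := growthFunction_pos s m
  exact div_nonneg (Real.log_nonneg (by exact_mod_cast hm)) (by positivity)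

theorem tendsto_growthRoot_exp {s : ι → G} {L : ℝ}
    (hL : Tendsto (fun m : ℕ => Real.log (growthFunction s m) / m) atTop (𝓝 L)) :
    Tendsto (growthRoot s) atTop (𝓝 (Real.exp L)) := by
  refine ((Real.continuous_exp.tendsto L).comp hL).congr fun m => ?_
  have hm := growthFunction_pos s m
  simp only [Function.comp, growthRoot]
  rw [Real.rpow_def_of_pos (by positivity), div_eq_mul_inv]

theorem growthRate_eq_exp {s : ι → G} {L : ℝ}
    (hL : Tendsto (fun m : ℕ => Real.log (growthFunction s m) / m) atTop (𝓝 L)) :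
    growthRate s = Real.exp L := (tendsto_growthRoot_exp hL).limUnder_eq

theorem tendsto_growthRoot (s : ι → G) :
    Tendsto (growthRoot s) atTop (𝓝 (growthRate s)) := by
  obtain ⟨L, hL⟩ := exists_tendsto_log_growthFunction s
  rw [growthRate_eq_exp hL]
  exact tendsto_growthRoot_exp hL

theorem growthRate_eq_one_of_polynomial (s : ι → G) {C k : ℕ}
    (h : ∀ m, growthFunction s m ≤ C * (m + 1) ^ k) : growthRate s = 1 := by
  obtain ⟨L, hL⟩ := exists_tendsto_log_growthFunction s
  suffices L = 0 by rw [growthRate_eq_exp hL, this, Real.exp_zero]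
  have hC : 0 < C := by
    have := (growthFunction_pos s 0).trans_le (h 0)
    simpa using this
  have h0 : Tendsto (fun m : ℕ => Real.log m / m) atTop (𝓝 0) := by
    have := (Real.isLittleO_log_id_atTop.tendsto_div_nhds_zero).comp tendsto_natCast_atTop_atTop
    exact this
  have h1 : Tendsto (fun m : ℕ => (Real.log C + k * Real.log 2) / m + k * (Real.log m / m))
      atTop (𝓝 (0 + k * 0)) :=
    (tendsto_const_div_atTop_nhds_zero_nat _).add (h0.const_mul _)
  have h2 : Tendsto (fun m : ℕ => Real.log (growthFunction s m) / m) atTop (𝓝 0) := by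
    refine tendsto_of_tendsto_of_tendsto_of_le_of_le' tendsto_const_nhds (by simpa using h1) ?_ ?_
    · filter_upwards with m
      have hm := growthFunction_pos s m
      exact div_nonneg (Real.log_nonneg (by exact_mod_cast hm)) (by positivity)
    · filter_upwards [eventually_ge_atTop 1] with m hm
      have hm' : (1 : ℝ) ≤ m := by exact_mod_cast hm
      have hb := growthFunction_pos s m
      rw [← mul_div_assoc, ← add_div]
      gcongr
      calc Real.log (growthFunction s m) ≤ Real.log (C * (2 * m) ^ k) := by
            refine Real.log_le_log (by positivity) ?_
            calc (growthFunction s m : ℝ) ≤ C * (m + 1) ^ k := by exact_mod_cast h m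
              _ ≤ C * (2 * m) ^ k := by gcongr; linarith
        _ = _ := by
            rw [Real.log_mul (by positivity) (by positivity), Real.log_pow,
              Real.log_mul (by positivity) (by positivity)]
            ring
  exact tendsto_nhds_unique hL h2

theorem growthRate_ne_one_of_exponential (s : ι → G) {C N : ℕ}
    (h : ∀ m, 2 ^ m ≤ C * growthFunction s (N * m)) : growthRate s ≠ 1 := by
  obtain ⟨L, hL⟩ := exists_tendsto_log_growthFunction s
  rw [growthRate_eq_exp hL, Ne, Real.exp_eq_one_iff]
  rintro rfl
  have hC : 0 < C := by
    have := h 0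
    exact Nat.pos_of_ne_zero fun h0 => by simp [h0] at this
  have hN : 0 < N := by
    refine Nat.pos_of_ne_zero fun h0 => ?_
    -- For `N = 0` the right side is a constant, and taking that constant as `m` contradicts `m < 2
    -- ^ m`.
    subst h0
    have h1 := h (C * growthFunction s 0)
    rw [Nat.zero_mul] at h1
    exact absurd h1 (not_le.2 Nat.lt_two_pow_self)
  have h1 : Tendsto (fun m : ℕ => N * (Real.log (growthFunction s (N * m)) / (N * m : ℕ)) +
      Real.log C / m) atTop (𝓝 (N * 0 + 0)) := by
    refine Tendsto.add (Tendsto.const_mul _ ?_) (tendsto_const_div_atTop_nhds_zero_nat _)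
    exact hL.comp (tendsto_id.const_mul_atTop' hN)
  have h2 : Real.log 2 ≤ N * 0 + 0 := by
    refine ge_of_tendsto h1 ?_
    filter_upwards [eventually_ge_atTop 1] with m hm
    have hm' : (1 : ℝ) ≤ m := by exact_mod_cast hm
    have hb := growthFunction_pos s (N * m)
    have hlog : m * Real.log 2 ≤ Real.log C + Real.log (growthFunction s (N * m)) := by
      rw [← Real.log_mul (by positivity) (by positivity), ← Real.log_pow]
      exact Real.log_le_log (by positivity) (by exact_mod_cast h m)
    have hN' : (0 : ℝ) < N := by exact_mod_cast hN
    have : (N : ℝ) * (Real.log (growthFunction s (N * m)) / (N * m : ℕ)) + Real.log C / m =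
        (Real.log C + Real.log (growthFunction s (N * m))) / m := by
      push_cast
      field_simp
      ring
    rw [this, le_div_iff₀ (by positivity)]
    linarith
  have := Real.log_pos (by norm_num : (1 : ℝ) < 2)
  linarith

end Growth

/-! ### Alternating products and products of two reflections -/

section AltProd

variable {G H : Type*} [Group G] [Group H]

theorem altProd_two_mul (a b : G) (j : ℕ) : altProd a b (2 * j) = (a * b) ^ j := by
  induction j with
  | zero => simp [altProd]
  | succ j ih =>
    rw [mul_add, pow_succ', ← ih]
    simp [altProd, mul_assoc]

theorem altProd_two_mul_add_one (a b : G) (j : ℕ) :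
    altProd a b (2 * j + 1) = (a * b) ^ j * a := by
  induction j with
  | zero => simp [altProd]
  | succ j ih =>
    rw [mul_add, pow_succ', mul_assoc, ← ih]
    simp [altProd, mul_assoc]

theorem map_altProd (f : G →* H) (a b : G) (k : ℕ) :
    f (altProd a b k) = altProd (f a) (f b) k := by
  induction k generalizing a b with
  | zero => simp [altProd]
  | succ k ih => simp [altProd, ih]

theorem altProd_comm_of_mul_pow_eq_one {a b : G} (ha : a * a = 1) (hb : b * b = 1) {k : ℕ}
    (h : (a * b) ^ k = 1) : altProd a b k = altProd b a k := by
  have hinv : b * a = (a * b)⁻¹ := by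
    rw [mul_inv_rev, inv_eq_of_mul_eq_one_left ha, inv_eq_of_mul_eq_one_left hb]
  obtain ⟨j, rfl | rfl⟩ := Nat.even_or_odd' k
  · rw [altProd_two_mul, altProd_two_mul, hinv, inv_pow, eq_inv_iff_mul_eq_one, ← pow_add,
      ← two_mul, h]
  · rw [altProd_two_mul_add_one, altProd_two_mul_add_one, hinv, inv_pow, eq_inv_mul_iff_mul_eq,
      ← mul_assoc, ← pow_add, ← two_mul, ← mul_left_inj b, mul_assoc, ← pow_succ, h, hb]

theorem altProd_two_comm {a b : G} (h : a * b = b * a) : altProd a b 2 = altProd b a 2 := by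
  simpa [altProd] using h

theorem altProd_one_comm (b : G) : altProd 1 b 2 = altProd b 1 2 := by simp [altProd]

end AltProd

section Reflections

open Polynomial Polynomial.Chebyshev Real

theorem chebyshevS_eval_mul_sin (θ : ℝ) (n : ℤ) :
    (S ℝ n).eval (2 * cos θ) * sin θ = sin ((n + 1) * θ) := by
  have key : ∀ n : ℕ, (S ℝ n).eval (2 * cos θ) * sin θ = sin ((n + 1) * θ) ∧
      (S ℝ (n + 1)).eval (2 * cos θ) * sin θ = sin ((n + 1 + 1) * θ) := by
    intro n
    induction n with
    | zero =>
      refine ⟨by simp, ?_⟩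
      simp only [Nat.cast_zero, zero_add, S_one, eval_X]
      rw [show ((1 : ℝ) + 1) * θ = 2 * θ by ring, sin_two_mul]
      ring
    | succ n ih =>
      refine ⟨by have := ih.2; push_cast at this ⊢; exact this, ?_⟩
      have h1 := ih.1
      have h2 := ih.2
      have h3 := S_add_two ℝ n
      push_cast
      rw [show (n : ℤ) + 1 + 1 = n + 2 by ring, h3]
      simp only [eval_sub, eval_mul, eval_X]
      rw [show ((n : ℝ) + 1 + 1 + 1) * θ = (n + 1 + 1) * θ + θ by ring, sin_add]
      rw [show ((n : ℝ) + 1) * θ = (n + 1 + 1) * θ - θ by ring, sin_sub] at h1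
      linear_combination 2 * cos θ * h2 - h1
  obtain hn | hn := le_or_gt 0 n
  · lift n to ℕ using hn
    exact_mod_cast (key n).1
  · obtain ⟨k, rfl⟩ : ∃ k : ℕ, n = -k - 1 := ⟨(-n - 1).toNat, by omega⟩
    rw [S_neg_sub_one]
    rcases k with _ | k
    · simp
    · have := (key k).1
      push_cast at this ⊢
      rw [show (k : ℤ) + 1 - 1 = k by ring]
      simp only [eval_neg]
      rw [show (-((k : ℝ) + 1) - 1 + 1) * θ = -((k + 1) * θ) by ring, sin_neg]
      linear_combination -this

/-- Powers of a product of two reflections have coefficients given by Chebyshev values at `f y * g x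
- 2 = 2 cos (2π / k)`. For the `k`-th power each coefficient has a factor that is a multiple of `sin
π` and so vanishes. The case `k = 2` is separate because then `sin (2π / k) = 0`. No invariant form
is needed, so the lemma also serves affine reflections after linearisation. -/
theorem reflection_mul_reflection_pow_eq_one {E : Type*} [AddCommGroup E] [Module ℝ E] {x y : E}
    {f g : Module.Dual ℝ E} (hf : f x = 2) (hg : g y = 2) {k : ℕ} (hk : 2 ≤ k)
    (hfy : f y = -(2 * cos (π / k))) (hgx : g x = -(2 * cos (π / k))) :
    (Module.reflection hf * Module.reflection hg) ^ k = 1 := by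
  ext z
  rw [Module.reflection_mul_reflection_pow_apply hf hg k z]
  obtain rfl | hk3 : k = 2 ∨ 3 ≤ k := by omega
  · simp only [Nat.cast_ofNat, cos_pi_div_two, mul_zero, neg_zero] at hfy hgx
    simp only [hfy, hgx]
    simp
    module
  have hk0 : (0 : ℝ) < k := by positivity
  have hk3' : (3 : ℝ) ≤ k := by exact_mod_cast hk3
  have ht : f y * g x - 2 = 2 * cos (2 * π / k) := by
    rw [hfy, hgx, mul_div_assoc, cos_two_mul]
    ring
  have hsin : sin (2 * π / k) ≠ 0 := by
    refine (sin_pos_of_pos_of_lt_pi (by positivity) ?_).ne'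
    rw [div_lt_iff₀ hk0]
    nlinarith [pi_pos]
  have hS : ∀ n : ℤ, (S ℝ n).eval (2 * cos (2 * π / k)) =
      sin ((n + 1) * (2 * π / k)) / sin (2 * π / k) := fun n => by
    rw [eq_div_iff hsin, chebyshevS_eval_mul_sin]
  rw [ht]
  obtain ⟨j, hj | hj⟩ := Nat.even_or_odd' k
  · have h0 : (S ℝ ((j : ℤ) - 1)).eval (2 * cos (2 * π / k)) = 0 := by
      rw [hS, div_eq_zero_iff]
      left
      have hj0 : (j : ℝ) ≠ 0 := by
        rw [Nat.cast_ne_zero]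
        omega
      rw [show (((j : ℤ) - 1 : ℤ) + 1 : ℝ) * (2 * π / k) = π by
        rw [hj]; push_cast; field_simp; ring]
      exact sin_pi
    rw [show ((k : ℤ) - 2) / 2 = j - 1 by omega, show ((k : ℤ) - 1) / 2 = j - 1 by omega, h0]
    simp
  · have h0 : (S ℝ (j : ℤ)).eval (2 * cos (2 * π / k)) +
        (S ℝ ((j : ℤ) - 1)).eval (2 * cos (2 * π / k)) = 0 := by
      rw [hS, hS, ← add_div, div_eq_zero_iff]
      left
      rw [sin_add_sin, show (((j : ℤ) + 1 : ℝ) * (2 * π / k) +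
        (((j : ℤ) - 1 : ℤ) + 1 : ℝ) * (2 * π / k)) / 2 = π by
          rw [hj] at hk0 ⊢; push_cast at hk0 ⊢; field_simp; ring]
      simp
    rw [show ((k : ℤ) - 2) / 2 = j - 1 by omega, show ((k : ℤ) - 1) / 2 = j by omega,
      show (k : ℤ) / 2 = j by omega, show ((k : ℤ) - 3) / 2 = j - 1 by omega, h0]
    simp

end Reflections

/-! ### Homomorphisms out of a Dyer group -/

namespace DyerSystem

variable {V : Type*} {M : DyerMatrix V} {D : Type*} [Group D] (ds : DyerSystem M D)

theorem exists_lift {G : Type*} [Group G] (g : V → G)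
    (h1 : ∀ v (k : ℕ), M.entry v v = k → g v ^ k = 1)
    (h2 : ∀ u v (k : ℕ), u ≠ v → M.entry u v = k → altProd (g u) (g v) k = altProd (g v) (g u) k) :
    ∃ φ : D →* G, ∀ v, φ (ds.gen v) = g v := by
  have h : ∀ r ∈ M.relators, FreeGroup.lift g r = 1 := by
    rintro r (⟨v, k, hk, rfl⟩ | ⟨u, v, k, huv, hk, rfl⟩)
    · simpa using h1 v k hk
    · rw [map_mul, map_inv, map_altProd, map_altProd, mul_inv_eq_one]
      simpa using h2 u v k huv hk
  refine ⟨(PresentedGroup.toGroup h).comp ds.mulEquiv.toMonoidHom, fun v => ?_⟩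
  simp [gen]

theorem gen_pow {v : V} {k : ℕ} (h : M.entry v v = k) : ds.gen v ^ k = 1 := by
  rw [gen, ← map_pow, ← map_one ds.mulEquiv.symm]
  congr 1
  exact PresentedGroup.one_of_mem (rels := M.relators) (Or.inl ⟨v, k, h, rfl⟩)

theorem altProd_gen {u v : V} (huv : u ≠ v) {k : ℕ} (h : M.entry u v = k) :
    altProd (ds.gen u) (ds.gen v) k = altProd (ds.gen v) (ds.gen u) k := by
  have h1 := PresentedGroup.one_of_mem (rels := M.relators) (Or.inr ⟨u, v, k, huv, h, rfl⟩)
  rw [map_mul, map_inv, mul_inv_eq_one, map_altProd, map_altProd] at h1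
  have h2 := congrArg ds.mulEquiv.symm.toMonoidHom h1
  rw [map_altProd, map_altProd] at h2
  exact h2

theorem gen_mul_gen_of_entry_eq_two {u v : V} (huv : u ≠ v) (h : M.entry u v = 2) :
    ds.gen u * ds.gen v = ds.gen v * ds.gen u := by
  simpa [altProd] using ds.altProd_gen huv (k := 2) h

theorem gen_mul_self {v : V} (h : M.entry v v = 2) : ds.gen v * ds.gen v = 1 := by
  rw [← sq]
  exact ds.gen_pow (k := 2) h

end DyerSystem

/-! ### Roots of a cosine matrix -/

/-- A symmetric matrix with unit diagonal and off-diagonal entries in `[-1, 0]`. -/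
structure IsCosineMatrix {X : Type*} (A : Matrix X X ℝ) : Prop where
  symm : ∀ i j, A i j = A j i
  diag : ∀ i, A i i = 1
  nonpos : ∀ i j, i ≠ j → A i j ≤ 0
  neg_one_le : ∀ i j, -1 ≤ A i j

section Gram

variable {X : Type*} [Fintype X] [DecidableEq X] {A : Matrix X X ℝ}

/-- The bilinear form with Gram matrix `A` in the standard basis. -/
noncomputable def gramForm (A : Matrix X X ℝ) : LinearMap.BilinForm ℝ (X → ℝ) := Matrix.toBilin' A

theorem gramForm_single_single (A : Matrix X X ℝ) (i j : X) :
    gramForm A (Pi.single i 1) (Pi.single j 1) = A i j := Matrix.toBilin'_single A i j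

theorem gramForm_apply (A : Matrix X X ℝ) (x y : X → ℝ) :
    gramForm A x y = ∑ i, ∑ j, x i * A i j * y j := Matrix.toBilin'_apply A x y

theorem gramForm_eq_sum (A : Matrix X X ℝ) (x y : X → ℝ) :
    gramForm A x y = ∑ i, x i * gramForm A (Pi.single i 1) y := by
  conv_lhs => rw [pi_eq_sum_univ' x]
  simp only [map_sum, LinearMap.sum_apply, map_smul, LinearMap.smul_apply, smul_eq_mul]

theorem gramForm_comm (hA : ∀ i j, A i j = A j i) (x y : X → ℝ) :
    gramForm A x y = gramForm A y x := by
  rw [gramForm_apply, gramForm_apply, Finset.sum_comm]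
  refine Finset.sum_congr rfl fun i _ => Finset.sum_congr rfl fun j _ => ?_
  rw [hA]
  ring

theorem continuous_gramForm_self (A : Matrix X X ℝ) : Continuous fun x => gramForm A x x := by
  simp only [gramForm_apply]
  fun_prop

/-- The roots of `A`: the orbit of the standard basis under the simple reflections. -/
inductive IsRoot (A : Matrix X X ℝ) : (X → ℝ) → Prop
  | simple (i : X) : IsRoot A (Pi.single i 1)
  | reflect (i : X) (β : X → ℝ) (h : IsRoot A β) :
      IsRoot A (β - (2 * gramForm A (Pi.single i 1) β) • Pi.single i 1)

theorem IsCosineMatrix.gramForm_single_self (hA : IsCosineMatrix A) (i : X) :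
    gramForm A (Pi.single i 1) (Pi.single i 1) = 1 := by
  rw [gramForm_single_single, hA.diag]

theorem IsRoot.neg (hA : IsCosineMatrix A) {β : X → ℝ} (h : IsRoot A β) : IsRoot A (-β) := by
  induction h with
  | simple i =>
    convert IsRoot.reflect i _ (IsRoot.simple (A := A) i) using 1
    rw [hA.gramForm_single_self]
    module
  | reflect i β h ih =>
    convert IsRoot.reflect i _ ih using 1
    rw [map_neg]
    module

theorem IsRoot.gramForm_self (hA : IsCosineMatrix A) {β : X → ℝ} (h : IsRoot A β) :
    gramForm A β β = 1 := by
  induction h with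
  | simple i => exact hA.gramForm_single_self i
  | reflect i β h ih =>
    simp only [map_sub, map_smul, LinearMap.sub_apply, LinearMap.smul_apply, smul_eq_mul, ih,
      hA.gramForm_single_self, gramForm_comm hA.symm β]
    ring

/-- Nonnegative limits of rescaled roots whose size tends to infinity. -/
def IsLimitRoot (A : Matrix X X ℝ) (η : X → ℝ) : Prop :=
  ∃ (β : ℕ → X → ℝ) (c : ℕ → ℝ), (∀ k, IsRoot A (β k)) ∧ (∀ k, 0 < c k) ∧
    Tendsto c atTop (𝓝 0) ∧ Tendsto (fun k => c k • β k) atTop (𝓝 η)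

theorem IsLimitRoot.neg (hA : IsCosineMatrix A) {η : X → ℝ} (h : IsLimitRoot A η) :
    IsLimitRoot A (-η) := by
  obtain ⟨β, c, h1, h2, h3, h4⟩ := h
  exact ⟨fun k => -β k, c, fun k => (h1 k).neg hA, h2, h3, by simpa using h4.neg⟩

theorem IsLimitRoot.reflect (i : X) {η : X → ℝ} (h : IsLimitRoot A η) :
    IsLimitRoot A (η - (2 * gramForm A (Pi.single i 1) η) • Pi.single i 1) := by
  obtain ⟨β, c, h1, h2, h3, h4⟩ := h
  refine ⟨fun k => β k - (2 * gramForm A (Pi.single i 1) (β k)) • Pi.single i 1, c,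
    fun k => (h1 k).reflect i, h2, h3, ?_⟩
  have hc : Continuous fun x : X → ℝ => x - (2 * gramForm A (Pi.single i 1) x) •
      (Pi.single i 1 : X → ℝ) := by
    have : Continuous fun x : X → ℝ => gramForm A (Pi.single i 1) x :=
      LinearMap.continuous_of_finiteDimensional _
    exact continuous_id.sub ((continuous_const.mul this).smul continuous_const)
  refine ((hc.tendsto η).comp h4).congr fun k => ?_
  simp only [Function.comp, map_smul, smul_eq_mul]
  module

/-- Every root has square 1, so the rescaled roots have squares `c k ^ 2`, which tend to 0: limit
roots are isotropic. -/
theorem IsLimitRoot.gramForm_self (hA : IsCosineMatrix A) {η : X → ℝ} (h : IsLimitRoot A η) :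
    gramForm A η η = 0 := by
  obtain ⟨β, c, h1, h2, h3, h4⟩ := h
  refine tendsto_nhds_unique (((continuous_gramForm_self A).tendsto η).comp h4) ?_
  have := h3.mul h3
  rw [mul_zero] at this
  refine this.congr fun k => ?_
  simp [(h1 k).gramForm_self hA]

/-! ### Lorentzian geometry of a minimal indefinite matrix. -/

section Minimal

variable (hA : IsCosineMatrix A) (hneg : ∃ x, gramForm A x x < 0)
  (hmin : ∀ x i, x i = 0 → 0 ≤ gramForm A x x)

include hA hneg hmin in
/-- A minimal indefinite cosine matrix has a positive eigenvector with negative eigenvalue. -/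
theorem exists_pos_eigenvector : ∃ (v : X → ℝ) (μ : ℝ), 0 < μ ∧ (∀ i, 0 < v i) ∧
    ∀ i, gramForm A (Pi.single i 1) v = -(μ * v i) := by
  obtain ⟨x, hx⟩ := hneg
  have hscale : ∀ (t : ℝ) (y : X → ℝ), gramForm A (t • y) (t • y) = t ^ 2 * gramForm A y y :=
    fun t y => by
      simp only [map_smul, LinearMap.smul_apply, smul_eq_mul]
      ring
  have hpos : ∀ y : X → ℝ, y ≠ 0 → 0 < y ⬝ᵥ y := fun y hy =>
    lt_of_le_of_ne (Finset.sum_nonneg fun i _ => mul_self_nonneg (y i))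
      fun h => hy (dotProduct_self_eq_zero.1 h.symm)
  have hnorm : ∀ y : X → ℝ, y ≠ 0 → ((√(y ⬝ᵥ y))⁻¹ • y) ⬝ᵥ ((√(y ⬝ᵥ y))⁻¹ • y) = 1 := by
    intro y hy
    have h1 := hpos y hy
    rw [smul_dotProduct, dotProduct_smul, smul_smul, smul_eq_mul, ← mul_inv,
      Real.mul_self_sqrt h1.le, inv_mul_cancel₀ h1.ne']
  have hx0 : x ≠ 0 := by
    rintro rfl
    simp at hx
  let K : Set (X → ℝ) := {y | y ⬝ᵥ y = 1}
  have hK : IsCompact K := by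
    refine Metric.isCompact_of_isClosed_isBounded (isClosed_eq (by fun_prop) continuous_const) ?_
    refine (Metric.isBounded_closedBall (x := (0 : X → ℝ)) (r := 1)).subset fun y hy => ?_
    rw [mem_closedBall_zero_iff, pi_norm_le_iff_of_nonneg zero_le_one]
    intro i
    have h1 : y i * y i ≤ y ⬝ᵥ y :=
      Finset.single_le_sum (f := fun i => y i * y i) (fun j _ => mul_self_nonneg (y j))
        (Finset.mem_univ i)
    rw [show y ⬝ᵥ y = 1 from hy] at h1
    rw [Real.norm_eq_abs, abs_le]
    constructor <;> nlinarith
  obtain ⟨w, hwK, hw⟩ := hK.exists_isMinOn ⟨_, hnorm x hx0⟩ (continuous_gramForm_self A).continuousOn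
  obtain ⟨μ, hμ⟩ : ∃ μ, gramForm A w w = -μ := ⟨_, (neg_neg _).symm⟩
  have hlow : ∀ y : X → ℝ, -(μ * (y ⬝ᵥ y)) ≤ gramForm A y y := by
    intro y
    by_cases hy : y = 0
    · simp [hy]
    have h1 := hw (hnorm y hy)
    have h2 := hpos y hy
    simp only [Set.mem_ofPred_eq, hscale, inv_pow, Real.sq_sqrt h2.le, hμ] at h1
    rw [inv_mul_eq_div, le_div_iff₀ h2] at h1
    linarith
  have hμ0 : 0 < μ := by
    have := hlow x
    have := hpos x hx0
    by_contra! h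
    nlinarith
  -- Since off-diagonal entries are nonpositive, taking absolute values does not increase the form,
  -- so `v` is again a minimiser on the unit sphere. A zero coordinate of `v` would contradict
  -- minimality of the matrix.
  let v : X → ℝ := fun i => |w i|
  have hvv : v ⬝ᵥ v = 1 := by
    rw [← show w ⬝ᵥ w = 1 from hwK]
    simp [v, dotProduct]
  have hqv : gramForm A v v ≤ -μ := by
    rw [← hμ, gramForm_apply, gramForm_apply]
    refine Finset.sum_le_sum fun i _ => Finset.sum_le_sum fun j _ => ?_
    by_cases hij : i = j
    · subst hij
      simp only [v, hA.diag, mul_one, abs_mul_abs_self, le_refl]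
    · have h1 := hA.nonpos i j hij
      have h2 : w i * w j ≤ v i * v j := by
        simp only [v, ← abs_mul]
        exact le_abs_self _
      nlinarith
  refine ⟨v, μ, hμ0, fun i => lt_of_le_of_ne (abs_nonneg _) fun h => ?_, fun i => ?_⟩
  · linarith [hmin v i h.symm]
  -- First-order condition at the minimiser: perturb along the `i`-th basis vector, then insert the
  -- `t` that minimises the quadratic, which forces the linear coefficient to vanish.
  · have hall : ∀ t : ℝ, 0 ≤ 2 * t * (gramForm A (Pi.single i 1) v + μ * v i) +
        t ^ 2 * (1 + μ) := by
      intro t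
      have h1 := hlow (v + t • Pi.single i 1)
      simp only [map_add, map_smul, LinearMap.add_apply, LinearMap.smul_apply, smul_eq_mul,
        hA.gramForm_single_self, gramForm_comm hA.symm v, add_dotProduct, dotProduct_add,
        smul_dotProduct, dotProduct_smul, single_dotProduct, dotProduct_single, hvv,
        Pi.add_apply, Pi.smul_apply, Pi.single_eq_same] at h1
      nlinarith
    have h1 := hall (-(gramForm A (Pi.single i 1) v + μ * v i) / (1 + μ))
    have h2 : 2 * (-(gramForm A (Pi.single i 1) v + μ * v i) / (1 + μ)) *
        (gramForm A (Pi.single i 1) v + μ * v i) +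
        (-(gramForm A (Pi.single i 1) v + μ * v i) / (1 + μ)) ^ 2 * (1 + μ) =
        -((gramForm A (Pi.single i 1) v + μ * v i) ^ 2 / (1 + μ)) := by
      field_simp
      ring
    rw [h2] at h1
    have h3 : (gramForm A (Pi.single i 1) v + μ * v i) ^ 2 / (1 + μ) ≤ 0 := by linarith
    rw [div_le_iff₀ (by linarith), zero_mul] at h3
    have h4 := pow_eq_zero_iff (two_ne_zero) |>.1 (le_antisymm h3 (sq_nonneg _))
    linarith

variable {v : X → ℝ} {μ : ℝ} (hμ : 0 < μ) (hv : ∀ i, 0 < v i)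
  (hAv : ∀ i, gramForm A (Pi.single i 1) v = -(μ * v i))

include hμ hv hAv in
theorem gramForm_eigenvector_neg [Nonempty X] : gramForm A v v < 0 := by
  rw [gramForm_eq_sum]
  refine Finset.sum_neg (fun i _ => ?_) Finset.univ_nonempty
  rw [hAv]
  have := hv i
  have : 0 < v i * (μ * v i) := by positivity
  linarith

include hA hmin hμ hv hAv in
-- Subtracting from `x` the multiple of `v` that kills the `i`-th coordinate leaves a vector on
-- which minimality makes the form nonnegative. As `x ⟂ v`, this bounds the square of `x` below by
-- `(x i / v i) ^ 2` times the positive number `-gramForm A v v`. So the form is positive definite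
-- on the orthogonal complement of `v`.
theorem gramForm_nonneg_of_orthogonal {x : X → ℝ} (hx : gramForm A x v = 0) :
    0 ≤ gramForm A x x ∧ (gramForm A x x = 0 → x = 0) := by
  have key : ∀ i, (x i) ^ 2 / (v i) ^ 2 * -gramForm A v v ≤ gramForm A x x := by
    intro i
    have hvi := hv i
    have h1 := hmin (x + (-(x i / v i)) • v) i (by simp; field_simp; ring)
    simp only [map_add, map_smul, LinearMap.add_apply, LinearMap.smul_apply, smul_eq_mul, hx,
      gramForm_comm hA.symm v x] at h1
    rw [← div_pow]
    nlinarith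
  refine ⟨?_, fun h => funext fun i => ?_⟩
  · by_cases hX : Nonempty X
    · obtain ⟨i⟩ := hX
      have : Nonempty X := ⟨i⟩
      have h1 := gramForm_eigenvector_neg hμ hv hAv
      refine le_trans (mul_nonneg (by positivity) (by linarith)) (key i)
    · rw [gramForm_eq_sum]
      exact Finset.sum_nonneg fun i => (hX ⟨i⟩).elim
  · have : Nonempty X := ⟨i⟩
    have h1 := gramForm_eigenvector_neg hμ hv hAv
    have h2 := key i
    rw [h] at h2
    have hvi := hv i
    by_contra hxi
    have h3 : 0 < x i ^ 2 / v i ^ 2 := by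
      have : x i ≠ 0 := hxi
      positivity
    nlinarith

include hA hmin hμ hv hAv in
-- Reverse Cauchy–Schwarz for the light cone: the combination of `η₁` and `η₂` orthogonal to `v` is
-- nonzero, hence has positive square, and that square is a negative multiple of `gramForm A η₁ η₂`.
theorem gramForm_neg_of_null {η₁ η₂ : X → ℝ} (h₁ : gramForm A η₁ η₁ = 0)
    (h₂ : gramForm A η₂ η₂ = 0) (hp₁ : gramForm A η₁ v < 0) (hp₂ : gramForm A η₂ v < 0)
    (hli : LinearIndependent ℝ ![η₁, η₂]) : gramForm A η₁ η₂ < 0 := by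
  obtain ⟨h, h'⟩ := gramForm_nonneg_of_orthogonal hA hmin hμ hv hAv
    (x := gramForm A η₂ v • η₁ - gramForm A η₁ v • η₂) (by simp; ring)
  have hform : gramForm A (gramForm A η₂ v • η₁ - gramForm A η₁ v • η₂)
      (gramForm A η₂ v • η₁ - gramForm A η₁ v • η₂) =
      -(2 * (gramForm A η₁ v * gramForm A η₂ v) * gramForm A η₁ η₂) := by
    simp only [map_sub, map_smul, LinearMap.sub_apply, LinearMap.smul_apply, smul_eq_mul, h₁, h₂,
      gramForm_comm hA.symm η₂ η₁]
    ring
  rw [hform] at h h'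
  have hpp := mul_pos_of_neg_of_neg hp₁ hp₂
  by_contra! hcon
  have h0 : gramForm A η₁ η₂ = 0 := by
    refine le_antisymm ?_ hcon
    by_contra! hlt
    nlinarith [mul_pos hpp hlt]
  have hz := h' (by rw [h0]; ring)
  rw [LinearIndependent.pair_iff] at hli
  have := (hli (gramForm A η₂ v) (-gramForm A η₁ v) (by rw [neg_smul, ← sub_eq_add_neg]; exact hz)).1
  linarith

include hA hμ hv hAv in
-- Some simple reflection multiplies the height `-gramForm A β v` by at least `q = 1 + 2μ / n`.
-- Indeed `gramForm A v β` is the sum of the `n` terms `v i * gramForm A (Pi.single i 1) β`, one of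
-- which is at most the average.
theorem exists_isRoot_lt [Nonempty X] (R : ℝ) : ∃ β, IsRoot A β ∧ gramForm A β v < -R := by
  set n : ℝ := (Fintype.card X : ℝ) with hn
  have hn0 : 0 < n := by
    rw [hn]
    exact_mod_cast Fintype.card_pos
  obtain ⟨i₀⟩ := ‹Nonempty X›
  set q := 1 + 2 * μ / n with hq
  have hq1 : 1 < q := by
    have : 0 < 2 * μ / n := by positivity
    linarith
  have hp₀ : 0 < μ * v i₀ := mul_pos hμ (hv i₀)
  have key : ∀ k : ℕ, ∃ β, IsRoot A β ∧ gramForm A β v ≤ -(q ^ k * (μ * v i₀)) := by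
    intro k
    induction k with
    | zero => exact ⟨_, .simple i₀, by rw [hAv]; simp⟩
    | succ k ih =>
      obtain ⟨β, hβ, hle⟩ := ih
      set p := -gramForm A β v with hp
      have hp0 : q ^ k * (μ * v i₀) ≤ p := by linarith
      have hqk : 0 < q ^ k * (μ * v i₀) := by positivity
      obtain ⟨i, -, hi⟩ : ∃ i ∈ Finset.univ, v i * gramForm A (Pi.single i 1) β ≤ -p / n := by
        have : Nonempty X := ⟨i₀⟩
        refine Finset.exists_le_of_sum_le Finset.univ_nonempty ?_
        rw [← gramForm_eq_sum, gramForm_comm hA.symm, Finset.sum_const, nsmul_eq_mul,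
          Finset.card_univ, ← hn]
        rw [hp]
        field_simp
        linarith
      refine ⟨_, hβ.reflect i, ?_⟩
      simp only [map_sub, map_smul, LinearMap.sub_apply, LinearMap.smul_apply, smul_eq_mul, hAv]
      have h1 : gramForm A β v = -p := by rw [hp, neg_neg]
      have h2 : q * p = p + 2 * μ * (p / n) := by rw [hq]; ring
      have h3 : q * (q ^ k * (μ * v i₀)) ≤ q * p := by gcongr
      have h4 : -p / n = -(p / n) := by ring
      rw [h4] at hi
      rw [h1, pow_succ']
      nlinarith
  obtain ⟨k, hk⟩ := pow_unbounded_of_one_lt (R / (μ * v i₀)) hq1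
  obtain ⟨β, hβ, hle⟩ := key k
  refine ⟨β, hβ, hle.trans_lt ?_⟩
  rw [div_lt_iff₀ hp₀] at hk
  linarith

include hA hμ hv hAv in
-- Unbounded heights force unbounded norms, and the normalised roots have a convergent subsequence
-- on the unit sphere.
theorem exists_isLimitRoot_ne_zero [Nonempty X] : ∃ η, η ≠ 0 ∧ IsLimitRoot A η := by
  choose β hβ hlt using fun k : ℕ => exists_isRoot_lt hA hμ hv hAv (k : ℝ)
  have hβ0 : ∀ k, 0 < ‖β k‖ := fun k => by
    rw [norm_pos_iff]
    intro h
    have := hlt k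
    rw [h] at this
    simp only [map_zero, LinearMap.zero_apply] at this
    have : (0 : ℝ) ≤ k := by positivity
    linarith
  have hsph : ∀ k, (‖β k‖)⁻¹ • β k ∈ Metric.sphere (0 : X → ℝ) 1 := fun k => by
    rw [mem_sphere_zero_iff_norm, norm_smul, norm_inv, norm_norm, inv_mul_cancel₀ (hβ0 k).ne']
  obtain ⟨η, hη, f, hf, hlim⟩ := (isCompact_sphere (0 : X → ℝ) 1).tendsto_subseq hsph
  refine ⟨η, ?_, fun k => β (f k), fun k => (‖β (f k)‖)⁻¹, fun k => hβ _,
    fun k => inv_pos.2 (hβ0 _), ?_, hlim⟩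
  · rintro rfl
    simp at hη
  · have hnorm : Tendsto (fun k => ‖β k‖) atTop atTop := by
      let φ := LinearMap.toContinuousLinearMap ((gramForm A).flip v)
      have hb : ∀ k : ℕ, (k : ℝ) ≤ (‖φ‖ + 1) * ‖β k‖ := fun k => by
        have h1 := φ.le_opNorm (β k)
        have h2 : φ (β k) = gramForm A (β k) v := rfl
        rw [h2, Real.norm_eq_abs] at h1
        have h3 := neg_le_abs (gramForm A (β k) v)
        have := hlt k
        have := hβ0 k
        linarith
      have hpos : 0 < ‖φ‖ + 1 := by positivity
      refine tendsto_atTop_mono (fun k => (div_le_iff₀' hpos).2 (hb k)) ?_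
      exact tendsto_natCast_atTop_atTop.atTop_div_const hpos
    exact tendsto_inv_atTop_zero.comp (hnorm.comp hf.tendsto_atTop)

include hA hmin hμ hv hAv in
-- The span is stable under the simple reflections, so it contains each basis vector not orthogonal
-- to it. If some basis vector were missing, the indices would split into two nonempty, mutually
-- orthogonal classes, and minimality applied to the two parts of `v` would contradict `gramForm A v
-- v < 0`.
theorem span_isLimitRoot [Nonempty X] : Submodule.span ℝ {η | IsLimitRoot A η} = ⊤ := by
  set U := Submodule.span ℝ {η | IsLimitRoot A η} with hU
  have hinv : ∀ i, ∀ x ∈ U, x - (2 * gramForm A (Pi.single i 1) x) • Pi.single i 1 ∈ U := by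
    intro i x hx
    induction hx using Submodule.span_induction with
    | mem x hx => exact Submodule.subset_span (IsLimitRoot.reflect i hx)
    | zero => simp
    | add x y _ _ hx hy =>
      convert U.add_mem hx hy using 1
      rw [map_add]
      module
    | smul t x _ hx =>
      convert U.smul_mem t hx using 1
      rw [map_smul, smul_eq_mul]
      module
  have hmem : ∀ i, ∀ x ∈ U, gramForm A (Pi.single i 1) x ≠ 0 → Pi.single i 1 ∈ U := by
    intro i x hx h
    have h1 := U.sub_mem hx (hinv i x hx)
    rw [sub_sub_cancel] at h1
    exact (U.smul_mem_iff (mul_ne_zero two_ne_zero h)).1 h1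
  obtain ⟨η, hη0, hη⟩ := exists_isLimitRoot_ne_zero hA hμ hv hAv
  have hηU : η ∈ U := Submodule.subset_span hη
  -- A vector in the radical is orthogonal to `v`, and definiteness there excludes nonzero isotropic
  -- vectors.
  obtain ⟨i₀, hi₀⟩ : ∃ i, gramForm A (Pi.single i 1) η ≠ 0 := by
    by_contra! h
    refine hη0 ((gramForm_nonneg_of_orthogonal hA hmin hμ hv hAv ?_).2 (hη.gramForm_self hA))
    rw [gramForm_comm hA.symm, gramForm_eq_sum]
    simp [h]
  have hall : ∀ i, Pi.single i 1 ∈ U := by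
    by_contra! hcon
    obtain ⟨j₀, hj₀⟩ := hcon
    have horth : ∀ i j, Pi.single i 1 ∈ U → Pi.single j 1 ∉ U → A i j = 0 := by
      intro i j hi hj
      by_contra h
      refine hj (hmem j _ hi ?_)
      rwa [gramForm_single_single, hA.symm]
    classical
    let x : X → ℝ := fun i => if Pi.single i 1 ∈ U then v i else 0
    have hcross : gramForm A x (v - x) = 0 := by
      rw [gramForm_apply]
      refine Finset.sum_eq_zero fun i _ => Finset.sum_eq_zero fun j _ => ?_
      by_cases hi : Pi.single i 1 ∈ U
      · by_cases hj : Pi.single j 1 ∈ U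
        · simp [x, hj]
        · simp [horth i j hi hj]
      · simp [x, hi]
    have h1 := hmin x j₀ (by simp [x, hj₀])
    have h2 := hmin (v - x) i₀ (by simp [x, hmem i₀ η hηU hi₀])
    have h3 := gramForm_eigenvector_neg hμ hv hAv
    have h4 : gramForm A v v =
        gramForm A x x + gramForm A (v - x) (v - x) + 2 * gramForm A x (v - x) := by
      simp only [map_sub, LinearMap.sub_apply, gramForm_comm hA.symm x v]
      ring
    linarith
  rw [eq_top_iff]
  rintro x -
  rw [pi_eq_sum_univ' x]
  exact U.sum_mem fun i _ => U.smul_mem _ (hall i)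

include hA hv hAv hμ in
-- At an index where `v` is largest, a single other index contributes at least `-v i`, as entries
-- are at least `-1`. The row sum is then nonnegative, against the negative eigenvalue.
theorem three_le_card [Nonempty X] : 3 ≤ Fintype.card X := by
  obtain ⟨i, -, hi⟩ := Finset.exists_max_image Finset.univ v Finset.univ_nonempty
  have h1 := hAv i
  rw [gramForm_comm hA.symm, gramForm_eq_sum] at h1
  simp only [gramForm_single_single] at h1
  rw [← Finset.add_sum_erase _ _ (Finset.mem_univ i), hA.diag] at h1
  by_contra! hcard
  have hcard' : (Finset.univ.erase i).card ≤ 1 := by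
    rw [Finset.card_erase_of_mem (Finset.mem_univ i), Finset.card_univ]
    omega
  have h2 : -v i ≤ ∑ j ∈ Finset.univ.erase i, v j * A j i := by
    rcases Nat.le_one_iff_eq_zero_or_eq_one.1 hcard' with h | h
    · rw [Finset.card_eq_zero.1 h, Finset.sum_empty]
      linarith [hv i]
    · obtain ⟨j, hj⟩ := Finset.card_eq_one.1 h
      rw [hj, Finset.sum_singleton]
      have := hi j (Finset.mem_univ j)
      have := hA.neg_one_le j i
      have := hv j
      nlinarith
  have := mul_pos hμ (hv i)
  linarith

end Minimal

end Gram

/-! ### Three roots with pairwise products at most `-1`. -/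

section ThreeRoots

variable {X : Type*} [Fintype X] [DecidableEq X] {A : Matrix X X ℝ}

theorem tendsto_gramForm (A : Matrix X X ℝ) {f g : ℕ → X → ℝ} {x y : X → ℝ}
    (hf : Tendsto f atTop (𝓝 x)) (hg : Tendsto g atTop (𝓝 y)) :
    Tendsto (fun k => gramForm A (f k) (g k)) atTop (𝓝 (gramForm A x y)) := by
  simp only [gramForm_apply]
  exact tendsto_finsetSum _ fun i _ => tendsto_finsetSum _ fun j _ =>
    ((tendsto_pi_nhds.1 hf i).mul_const _).mul (tendsto_pi_nhds.1 hg j)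

/-- The spanning set of limit roots contains three independent ones, and signs can be chosen so that
all have negative product with `v`. Their pairwise products are then negative. Approximating roots
have rescaled products tending to these limits while `c i k * c j k` tends to 0, so the unscaled
products eventually fall to `-1` or below. -/
theorem exists_three_roots_of_minimal [Nonempty X] (hA : IsCosineMatrix A)
    (hneg : ∃ x, gramForm A x x < 0) (hmin : ∀ x i, x i = 0 → 0 ≤ gramForm A x x) :
    ∃ β : Fin 3 → X → ℝ, (∀ i, IsRoot A (β i)) ∧ ∀ i j, i ≠ j → gramForm A (β i) (β j) ≤ -1 := by
  obtain ⟨v, μ, hμ, hv, hAv⟩ := exists_pos_eigenvector hA hneg hmin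
  obtain ⟨b, hb, hspan, hli⟩ := exists_linearIndependent ℝ {η | IsLimitRoot A η}
  rw [span_isLimitRoot hA hmin hμ hv hAv] at hspan
  have hcard : 3 ≤ Nat.card b := by
    let B := Module.Basis.mk hli (by rw [Subtype.range_coe, hspan])
    rw [← Module.finrank_eq_nat_card_basis B, Module.finrank_fintype_fun_eq_card]
    exact three_le_card hA hμ hv hAv
  have hfin : Finite b := Nat.finite_of_card_ne_zero (by omega)
  let e := (Fin.castLEEmb hcard).trans (Finite.equivFin b).symm.toEmbedding
  have hη := hli.comp e e.injective
  have hsign : ∀ i, ∃ ε : ℝˣ, IsLimitRoot A (ε • (e i : X → ℝ)) ∧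
      gramForm A (ε • (e i : X → ℝ)) v < 0 := by
    intro i
    have h1 : IsLimitRoot A (e i : X → ℝ) := hb (e i).2
    have h0 : (e i : X → ℝ) ≠ 0 := hη.ne_zero i
    have h2 : gramForm A (e i : X → ℝ) v ≠ 0 := fun h =>
      h0 ((gramForm_nonneg_of_orthogonal hA hmin hμ hv hAv h).2 (h1.gramForm_self hA))
    rcases lt_or_gt_of_ne h2 with h | h
    · exact ⟨1, by simpa using h1, by simpa using h⟩
    · exact ⟨-1, by simpa using h1.neg hA, by simpa using h⟩
  choose ε hε hεv using hsign
  have hli' := hη.units_smul ε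
  have hpair : ∀ i j, i ≠ j → gramForm A (ε i • (e i : X → ℝ)) (ε j • (e j : X → ℝ)) < 0 := by
    intro i j hij
    refine gramForm_neg_of_null hA hmin hμ hv hAv ((hε i).gramForm_self hA)
      ((hε j).gramForm_self hA) (hεv i) (hεv j) ?_
    have h1 : Function.Injective ![i, j] := by
      intro a b hab
      fin_cases a <;> fin_cases b <;> simp_all [eq_comm]
    have h2 : ![ε i • (e i : X → ℝ), ε j • (e j : X → ℝ)] =
        (ε • (Subtype.val ∘ e)) ∘ ![i, j] := by
      ext k : 1
      fin_cases k <;> rfl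
    rw [h2]
    exact hli'.comp _ h1
  choose β c hβ hc hc0 hlim using hε
  have hev : ∀ i j, i ≠ j → ∀ᶠ k in atTop, gramForm A (β i k) (β j k) ≤ -1 := by
    intro i j hij
    have h1 : Tendsto (fun k => gramForm A (c i k • β i k) (c j k • β j k)) atTop
        (𝓝 (gramForm A (ε i • (e i : X → ℝ)) (ε j • (e j : X → ℝ)))) :=
      tendsto_gramForm A (hlim i) (hlim j)
    have h2 : Tendsto (fun k => gramForm A (c i k • β i k) (c j k • β j k) + c i k * c j k) atTop
        (𝓝 (gramForm A (ε i • (e i : X → ℝ)) (ε j • (e j : X → ℝ)) + 0 * 0)) :=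
      h1.add ((hc0 i).mul (hc0 j))
    have h3 := h2.eventually_lt_const (u := 0) (by simpa using hpair i j hij)
    filter_upwards [h3] with k hk
    simp only [map_smul, LinearMap.smul_apply, smul_eq_mul] at hk
    have := mul_pos (hc i k) (hc j k)
    by_contra! hcon
    nlinarith
  have hall : ∀ᶠ k in atTop, ∀ i j, i ≠ j → gramForm A (β i k) (β j k) ≤ -1 := by
    simpa only [eventually_all] using hev
  obtain ⟨k, hk⟩ := hall.exists
  exact ⟨fun i => β i k, fun i => hβ i k, hk⟩

variable {Y : Type*} [Fintype Y] [DecidableEq Y]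

theorem gramForm_submatrix (A : Matrix X X ℝ) {f : Y → X} (hf : Function.Injective f)
    (x y : Y → ℝ) : gramForm A (Function.ExtendByZero.linearMap ℝ f x)
      (Function.ExtendByZero.linearMap ℝ f y) = gramForm (A.submatrix f f) x y := by
  have hsum : ∀ (z : Y → ℝ) (g : X → ℝ),
      ∑ i, Function.extend f z 0 i * g i = ∑ k, z k * g (f k) := by
    intro z g
    rw [← Finset.sum_subset (Finset.subset_univ (Finset.univ.map ⟨f, hf⟩)), Finset.sum_map]
    · simp [hf.extend_apply]
    · intro i _ hi
      rw [Function.extend_apply', Pi.zero_apply, zero_mul]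
      simpa using hi
  rw [gramForm_apply, gramForm_apply]
  simp only [Function.ExtendByZero.linearMap_apply, mul_assoc, ← Finset.mul_sum]
  rw [hsum]
  refine Finset.sum_congr rfl fun i _ => ?_
  congr 1
  simp only [mul_comm (A _ _), hsum]
  exact Finset.sum_congr rfl fun j _ => mul_comm _ _

omit [Fintype X] in
theorem extendByZero_single {f : Y → X} (hf : Function.Injective f) (k : Y) :
    Function.ExtendByZero.linearMap ℝ f (Pi.single k 1) = Pi.single (f k) 1 := by
  ext i
  rw [Function.ExtendByZero.linearMap_apply]
  by_cases h : ∃ l, f l = i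
  · obtain ⟨l, rfl⟩ := h
    simp only [hf.extend_apply, Pi.single_apply, hf.eq_iff]
  · rw [Function.extend_apply' _ _ _ h, Pi.single_apply, if_neg]
    · rfl
    · rintro rfl
      exact h ⟨k, rfl⟩

theorem IsRoot.of_submatrix {f : Y → X} (hf : Function.Injective f) {β : Y → ℝ}
    (h : IsRoot (A.submatrix f f) β) : IsRoot A (Function.ExtendByZero.linearMap ℝ f β) := by
  induction h with
  | simple k =>
    rw [extendByZero_single hf]
    exact .simple _
  | reflect k β _ ih =>
    rw [map_sub, map_smul, ← gramForm_submatrix A hf, extendByZero_single hf]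
    exact ih.reflect (f k)

theorem IsCosineMatrix.submatrix {X Y : Type*} {A : Matrix X X ℝ} (hA : IsCosineMatrix A)
    {f : Y → X} (hf : Function.Injective f) : IsCosineMatrix (A.submatrix f f) where
  symm _ _ := hA.symm _ _
  diag _ := hA.diag _
  nonpos _ _ hij := hA.nonpos _ _ (hf.ne hij)
  neg_one_le _ _ := hA.neg_one_le _ _

/-- An indefinite cosine matrix has three roots with pairwise products at most `-1`. -/
theorem exists_three_roots (hA : IsCosineMatrix A) (hneg : ∃ x, gramForm A x x < 0) :
    ∃ β : Fin 3 → X → ℝ, (∀ i, IsRoot A (β i)) ∧ ∀ i j, i ≠ j → gramForm A (β i) (β j) ≤ -1 := by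
  classical
  induction hn : Fintype.card X using Nat.strong_induction_on generalizing X with
  | _ n ih =>
    subst hn
    by_cases hmin : ∀ x i, x i = 0 → 0 ≤ gramForm A x x
    · have : Nonempty X := by
        by_contra hX
        rw [not_nonempty_iff] at hX
        obtain ⟨x, hx⟩ := hneg
        simp [gramForm_apply] at hx
      exact exists_three_roots_of_minimal hA hneg hmin
    -- A vector with a zero coordinate witnesses indefiniteness of the principal submatrix without
    -- that index; roots of the submatrix extend by zero.
    · push Not at hmin
      obtain ⟨x, i, hxi, hx⟩ := hmin
      let f : {j // j ≠ i} → X := Subtype.val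
      have hf : Function.Injective f := Subtype.val_injective
      have hext : Function.ExtendByZero.linearMap ℝ f (x ∘ f) = x := by
        ext j
        rw [Function.ExtendByZero.linearMap_apply]
        by_cases hj : j = i
        · rw [Function.extend_apply', hj, hxi, Pi.zero_apply]
          rintro ⟨k, hk⟩
          exact k.2 (hk.trans hj)
        · exact hf.extend_apply _ _ (⟨j, hj⟩ : {j // j ≠ i})
      obtain ⟨β, h1, h2⟩ := ih (Fintype.card {j // j ≠ i})
        (Fintype.card_subtype_lt (x := i) (by simp)) (A := A.submatrix f f) (hA.submatrix hf)
        ⟨x ∘ f, by rw [← gramForm_submatrix A hf, hext]; exact hx⟩ rfl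
      exact ⟨fun k => Function.ExtendByZero.linearMap ℝ f (β k), fun k => (h1 k).of_submatrix hf,
        fun k l hkl => by rw [gramForm_submatrix A hf]; exact h2 k l hkl⟩

end ThreeRoots

/-! ### Free semigroups generated by reflections -/

section PingPong

variable {X : Type*} [Fintype X] [DecidableEq X] {A : Matrix X X ℝ}

/-- The simple reflections of a cosine matrix. -/
noncomputable def IsCosineMatrix.reflection (hA : IsCosineMatrix A) (i : X) :
    (X → ℝ) ≃ₗ[ℝ] (X → ℝ) :=
  Module.reflection (x := Pi.single i 1) (f := (2 : ℝ) • gramForm A (Pi.single i 1))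
    (by simp [hA.gramForm_single_self])

theorem IsCosineMatrix.reflection_apply (hA : IsCosineMatrix A) (i : X) (x : X → ℝ) :
    hA.reflection i x = x - (2 * gramForm A (Pi.single i 1) x) • Pi.single i 1 := by
  rw [IsCosineMatrix.reflection, Module.reflection_apply]
  rfl

theorem IsCosineMatrix.reflection_mul_self (hA : IsCosineMatrix A) (i : X) :
    hA.reflection i * hA.reflection i = 1 := by
  ext x : 1
  exact Module.involutive_reflection _ x

theorem IsCosineMatrix.reflection_inv (hA : IsCosineMatrix A) (i : X) :
    (hA.reflection i)⁻¹ = hA.reflection i :=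
  inv_eq_of_mul_eq_one_left (hA.reflection_mul_self i)

theorem IsCosineMatrix.gramForm_reflection (hA : IsCosineMatrix A) (i : X) (x y : X → ℝ) :
    gramForm A (hA.reflection i x) y = gramForm A x (hA.reflection i y) := by
  simp only [hA.reflection_apply, map_sub, map_smul, LinearMap.sub_apply, LinearMap.smul_apply,
    smul_eq_mul, gramForm_comm hA.symm x (Pi.single i 1)]
  ring

/-- Reflecting a root by a simple reflection conjugates the associated reflection. -/
theorem IsRoot.exists_reflection (hA : IsCosineMatrix A) {β : X → ℝ} (h : IsRoot A β) :
    ∃ g ∈ Subgroup.closure (Set.range hA.reflection),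
      ∀ x, g x = x - (2 * gramForm A β x) • β := by
  induction h with
  | simple i => exact ⟨_, Subgroup.subset_closure ⟨i, rfl⟩, hA.reflection_apply i⟩
  | reflect i β _ ih =>
    obtain ⟨g, hg, h⟩ := ih
    have hi := Subgroup.subset_closure (k := Set.range hA.reflection) ⟨i, rfl⟩
    refine ⟨hA.reflection i * g * hA.reflection i, mul_mem (mul_mem hi hg) hi, fun x => ?_⟩
    rw [← hA.reflection_apply, LinearEquiv.mul_apply, LinearEquiv.mul_apply, h, map_sub, map_smul,
      hA.gramForm_reflection]
    congr 1
    exact LinearEquiv.congr_fun (hA.reflection_mul_self i) x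

/-- Three reflections in roots with pairwise products at most `-1` yield a free semigroup. -/
theorem exists_free_semigroup (hA : IsCosineMatrix A) {β : Fin 3 → X → ℝ}
    (hβ : ∀ i, IsRoot A (β i)) (hβ' : ∀ i j, i ≠ j → gramForm A (β i) (β j) ≤ -1) :
    ∃ g : Bool → (X → ℝ) ≃ₗ[ℝ] (X → ℝ),
      (∀ b, g b ∈ Subgroup.closure (Set.range hA.reflection)) ∧
      ∀ l l' : List Bool, l.length = l'.length → (l.map g).prod = (l'.map g).prod → l = l' := by
  choose R hR hRx using fun i => (hβ i).exists_reflection hA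
  -- Ping-pong regions: only the `i`-th wall has been crossed, and the other two functionals
  -- dominate the depth beyond it. The bound `-1` on products makes `R i` carry every other region
  -- into `P i`.
  let P : Fin 3 → Set (X → ℝ) := fun i => {x | gramForm A (β i) x < 0 ∧
    ∀ j, j ≠ i → -gramForm A (β i) x ≤ gramForm A (β j) x}
  have hform : ∀ i j x, gramForm A (β j) (R i x) =
      gramForm A (β j) x - 2 * gramForm A (β i) x * gramForm A (β j) (β i) := fun i j x => by
    rw [hRx, map_sub, map_smul, smul_eq_mul]
  have hself : ∀ i x, gramForm A (β i) (R i x) = -gramForm A (β i) x := fun i x => by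
    rw [hform, (hβ i).gramForm_self hA]
    ring
  have hmap : ∀ i k, i ≠ k → ∀ x ∈ P k, R i x ∈ P i := by
    rintro i k hik x ⟨hx1, hx2⟩
    have hpi := hx2 i hik
    refine ⟨by rw [hself]; linarith, fun j hj => ?_⟩
    rw [hself, hform]
    have h1 := hβ' j i hj
    by_cases hjk : j = k
    · subst hjk
      nlinarith
    · have h2 := hx2 j hjk
      nlinarith
  have hdisj : ∀ i k, i ≠ k → ∀ x ∈ P k, x ∉ P i := by
    rintro i k hik x ⟨hx1, hx2⟩ ⟨hy1, -⟩
    have := hx2 i hik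
    linarith
  -- The vector `-(β 0 + β 1 + β 2)` has product at least 1 with each root, so it lies on the
  -- positive side of all three walls, and `R 1` moves it into `P 1`.
  let y : X → ℝ := R 1 (-(β 0 + β 1 + β 2))
  have hy : y ∈ P 1 := by
    have h01 := hβ' 0 1 (by decide)
    have h02 := hβ' 0 2 (by decide)
    have h12 := hβ' 1 2 (by decide)
    have h10 := hβ' 1 0 (by decide)
    have h20 := hβ' 2 0 (by decide)
    have h21 := hβ' 2 1 (by decide)
    have h00 := (hβ 0).gramForm_self hA
    have h11 := (hβ 1).gramForm_self hA
    have h22 := (hβ 2).gramForm_self hA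
    refine ⟨?_, fun j hj => ?_⟩
    · simp only [y, hself, map_neg, map_add]
      linarith
    · simp only [y, hself, hform, map_neg, map_add]
      fin_cases j
      · simp only [Fin.zero_eta, Fin.isValue]
        nlinarith
      · exact absurd rfl hj
      · simp only [Fin.reduceFinMk, Fin.isValue]
        nlinarith
  -- Both generators pass through `P 0` and return to `P 1` or `P 2`, so the region reached reveals
  -- the leading letter.
  let g : Bool → (X → ℝ) ≃ₗ[ℝ] (X → ℝ) := fun b => if b then R 1 * R 0 else R 2 * R 0
  have hgP : ∀ b x, x ∈ P 1 ∪ P 2 → g b x ∈ P (if b then 1 else 2) := by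
    intro b x hx
    have h0 : R 0 x ∈ P 0 := by
      rcases hx with hx | hx
      · exact hmap 0 1 (by decide) x hx
      · exact hmap 0 2 (by decide) x hx
    cases b
    · exact hmap 2 0 (by decide) _ h0
    · exact hmap 1 0 (by decide) _ h0
  have hgP' : ∀ b x, x ∈ P 1 ∪ P 2 → g b x ∈ P 1 ∪ P 2 := by
    intro b x hx
    have := hgP b x hx
    cases b
    · exact Or.inr this
    · exact Or.inl this
  have hlist : ∀ l : List Bool, (l.map g).prod y ∈ P 1 ∪ P 2 := by
    intro l
    induction l with
    | nil => exact Or.inl hy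
    | cons b l ih =>
      rw [List.map_cons, List.prod_cons]
      exact hgP' b _ ih
  refine ⟨g, fun b => ?_, fun l => ?_⟩
  · cases b
    · exact mul_mem (hR 2) (hR 0)
    · exact mul_mem (hR 1) (hR 0)
  · induction l with
    | nil =>
      intro l' hl _
      exact (List.length_eq_zero_iff.1 hl.symm).symm
    | cons b l ih =>
      intro l' hl h
      match l', hl, h with
      | b' :: l', hl, h =>
        have hb : b = b' := by
          have h1 := hgP b _ (hlist l)
          have h2 := hgP b' _ (hlist l')
          rw [← LinearEquiv.mul_apply, ← List.prod_cons, ← List.map_cons] at h1 h2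
          rw [← h] at h2
          cases b <;> cases b'
          · rfl
          · exact absurd h2 (hdisj 1 2 (by decide) _ h1)
          · exact absurd h2 (hdisj 2 1 (by decide) _ h1)
          · rfl
        subst hb
        simp only [List.map_cons, List.prod_cons, mul_right_inj] at h
        rw [ih l' (by simpa using hl) h]

theorem exists_exponential_family (hA : IsCosineMatrix A) (hneg : ∃ x, gramForm A x x < 0) :
    ∃ N : ℕ, ∀ m, 2 ^ m ≤ growthFunction hA.reflection (N * m) := by
  obtain ⟨β, hβ, hβ'⟩ := exists_three_roots hA hneg
  obtain ⟨g, hg, hfree⟩ := exists_free_semigroup hA hβ hβ'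
  choose N hN using fun b => exists_mem_wordBall (hg b)
  have hN' : ∀ b, g b ∈ wordBall hA.reflection (N true + N false) := by
    intro b
    refine wordBall_mono ?_ (hN b)
    cases b <;> omega
  refine ⟨N true + N false, fun m => ?_⟩
  have hmem : ∀ l : List Bool,
      (l.map g).prod ∈ wordBall hA.reflection ((N true + N false) * l.length) := by
    intro l
    induction l with
    | nil => exact one_mem_wordBall _
    | cons b l ih =>
      rw [List.map_cons, List.prod_cons, List.length_cons, mul_add, add_comm, mul_one]
      exact mul_mem_wordBall (hN' b) ih
  have hinj : Function.Injective fun l : List.Vector Bool m => (l.1.map g).prod :=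
    fun l l' h => Subtype.ext (hfree _ _ (l.2.trans l'.2.symm) h)
  have h1 := Set.ncard_le_ncard (s := Set.range fun l : List.Vector Bool m => (l.1.map g).prod)
    (t := wordBall hA.reflection ((N true + N false) * m)) (by
      rintro _ ⟨l, rfl⟩
      have := hmem l.1
      rwa [l.2] at this) (finite_wordBall _ _)
  rw [← Set.image_univ, Set.ncard_image_of_injective _ hinj, Set.ncard_univ,
    Nat.card_eq_fintype_card, card_vector, Fintype.card_bool] at h1
  exact h1

end PingPong

/-! ### The reflection representation of a Dyer group -/

/-- The number `cos (π / m)`, equal to `1` for `m = ∞`. -/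
noncomputable def cosEntry (m : ℕ∞) : ℝ := if m = ⊤ then 1 else Real.cos (Real.pi / m.toNat)

theorem cosEntry_coe (k : ℕ) : cosEntry k = Real.cos (Real.pi / k) := by simp [cosEntry]

theorem cosEntry_top : cosEntry ⊤ = 1 := by simp [cosEntry]

theorem cosEntry_two : cosEntry 2 = 0 := by
  rw [show (2 : ℕ∞) = ((2 : ℕ) : ℕ∞) from rfl, cosEntry_coe]
  simp

theorem cosEntry_le_one (m : ℕ∞) : cosEntry m ≤ 1 := by
  rw [cosEntry]
  split_ifs
  exacts [le_rfl, Real.cos_le_one _]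

theorem cosEntry_nonneg {m : ℕ∞} (h : 2 ≤ m) : 0 ≤ cosEntry m := by
  induction m with
  | top => simp [cosEntry_top]
  | coe k =>
    have hk : (2 : ℝ) ≤ k := by exact_mod_cast h
    rw [cosEntry_coe]
    refine Real.cos_nonneg_of_neg_pi_div_two_le_of_le ?_ ?_
    · have : 0 ≤ Real.pi / k := by positivity
      linarith [Real.pi_pos]
    · exact div_le_div_of_nonneg_left Real.pi_pos.le two_pos hk

theorem half_le_cosEntry {m : ℕ∞} (h : 3 ≤ m) : 1 / 2 ≤ cosEntry m := by
  induction m with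
  | top =>
    rw [cosEntry_top]
    norm_num
  | coe k =>
    have hk : (3 : ℝ) ≤ k := by exact_mod_cast h
    rw [cosEntry_coe, ← Real.cos_pi_div_three]
    refine Real.cos_le_cos_of_nonneg_of_le_pi (by positivity) ?_ ?_
    · linarith [Real.pi_pos]
    · exact div_le_div_of_nonneg_left Real.pi_pos.le (by norm_num) hk

theorem IsCosineMatrix.reflection_mul_pow {X : Type*} [Fintype X] [DecidableEq X]
    {A : Matrix X X ℝ} (hA : IsCosineMatrix A) {i j : X} {k : ℕ} (hk : 2 ≤ k)
    (h : A i j = -cosEntry k) : (hA.reflection i * hA.reflection j) ^ k = 1 := by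
  rw [cosEntry_coe] at h
  refine reflection_mul_reflection_pow_eq_one _ _ hk ?_ ?_
  · simp [gramForm_single_single, h]
  · simp [gramForm_single_single, hA.symm j i, h]

theorem IsCosineMatrix.commute_reflection {X : Type*} [Fintype X] [DecidableEq X]
    {A : Matrix X X ℝ} (hA : IsCosineMatrix A) {i j : X} (h : A i j = 0) :
    Commute (hA.reflection i) (hA.reflection j) := by
  have h1 := altProd_comm_of_mul_pow_eq_one (hA.reflection_mul_self i) (hA.reflection_mul_self j)
    (hA.reflection_mul_pow (i := i) (j := j) (k := 2) le_rfl
      (by rw [show ((2 : ℕ) : ℕ∞) = 2 from rfl, cosEntry_two, h, neg_zero]))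
  simp only [altProd, mul_one] at h1
  exact h1

namespace DyerMatrix

variable {V : Type*} (M : DyerMatrix V)

/-- The cosine matrix of the Coxeter group obtained from a Dyer group by adjoining, for each
generator `u` of order at least `3`, a reflection inverting `u` and commuting with the others. -/
noncomputable def extGram [DecidableEq V] :
    Matrix (V ⊕ {u // 3 ≤ M.entry u u}) (V ⊕ {u // 3 ≤ M.entry u u}) ℝ
  | .inl u, .inl v => if u = v then 1 else -cosEntry (M.entry u v)
  | .inl v, .inr u => if v = u.1 then -cosEntry (M.entry v v) else 0
  | .inr u, .inl v => if v = u.1 then -cosEntry (M.entry v v) else 0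
  | .inr u, .inr w => if u = w then 1 else 0

variable {M}

theorem entry_eq_two {v : V} (h : ¬ 3 ≤ M.entry v v) : M.entry v v = 2 := by
  have h2 := M.two_le v v
  generalize M.entry v v = m at *
  induction m with
  | top => simp at h
  | coe k =>
    norm_cast at *
    omega

variable [DecidableEq V]

theorem isCosineMatrix_extGram : IsCosineMatrix M.extGram where
  symm := by
    rintro (u | u) (v | v)
    · simp only [extGram, eq_comm (a := u), M.symm u]
    · rfl
    · rfl
    · simp only [extGram, eq_comm (a := u)]
  diag := by rintro (u | u) <;> simp [extGram]
  nonpos := by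
    rintro (u | u) (v | v) huv
    · have := cosEntry_nonneg (M.two_le u v)
      have h : u ≠ v := fun h => huv (by rw [h])
      simpa [extGram, h] using this
    · have := cosEntry_nonneg (M.two_le u u)
      simp only [extGram]
      split_ifs <;> linarith
    · have := cosEntry_nonneg (M.two_le v v)
      simp only [extGram]
      split_ifs <;> linarith
    · have h : u ≠ v := fun h => huv (by rw [h])
      simp [extGram, h]
  neg_one_le := by
    rintro (u | u) (v | v) <;> simp only [extGram] <;> split_ifs <;>
      first | linarith | linarith [cosEntry_le_one (M.entry u v)] |
        linarith [cosEntry_le_one (M.entry u u)] | linarith [cosEntry_le_one (M.entry v v)]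

end DyerMatrix

/-! ### Representing a Dyer group by reflections and comparing growth. -/

namespace DyerSystem

variable {V : Type*} [DecidableEq V] [Fintype V] {M : DyerMatrix V}
  [Fintype {u // 3 ≤ M.entry u u}] {D : Type*} [Group D] (ds : DyerSystem M D)

open DyerMatrix

/-- A generator of order `f ≥ 3` goes to a product of two reflections whose matrix entry is `-cos (π
/ f)`. Finite braid exponents at such a vertex equal 2, so only commutation has to be checked there.
-/
theorem exists_reflection_hom : ∃ φ : D →* ((V ⊕ {u // 3 ≤ M.entry u u} → ℝ) ≃ₗ[ℝ]
      (V ⊕ {u // 3 ≤ M.entry u u} → ℝ)),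
    (∀ v, ¬ 3 ≤ M.entry v v → φ (ds.gen v) = isCosineMatrix_extGram.reflection (.inl v)) ∧
    ∀ u : {u // 3 ≤ M.entry u u}, φ (ds.gen u) =
      isCosineMatrix_extGram.reflection (.inl u.1) * isCosineMatrix_extGram.reflection (.inr u) := by
  classical
  set r := (isCosineMatrix_extGram (M := M)).reflection with hr
  have hinl : ∀ u v, u ≠ v → M.entry u v = 2 → Commute (r (.inl u)) (r (.inl v)) := by
    intro u v huv h
    refine isCosineMatrix_extGram.commute_reflection ?_
    simp [extGram, huv, h, cosEntry_two]
  have hinr : ∀ u v, Commute (r (.inr u)) (r (.inr v)) := by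
    intro u v
    by_cases huv : u = v
    · rw [huv]
    · refine isCosineMatrix_extGram.commute_reflection ?_
      simp [extGram, huv]
  have hmix : ∀ v (u : {u // 3 ≤ M.entry u u}), v ≠ u.1 → Commute (r (.inl v)) (r (.inr u)) := by
    intro v u huv
    refine isCosineMatrix_extGram.commute_reflection ?_
    simp [extGram, huv]
  let g : V → ((V ⊕ {u // 3 ≤ M.entry u u} → ℝ) ≃ₗ[ℝ] (V ⊕ {u // 3 ≤ M.entry u u} → ℝ)) :=
    fun v => if h : 3 ≤ M.entry v v then r (.inl v) * r (.inr ⟨v, h⟩) else r (.inl v)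
  have hcomm : ∀ u v, u ≠ v → M.entry u v = 2 → Commute (g u) (g v) := by
    intro u v huv h
    simp only [g]
    split_ifs
    · exact ((hinl u v huv h).mul_right (hmix _ _ huv)).mul_left
        ((hmix _ _ huv.symm).symm.mul_right (hinr _ _))
    · exact (hinl u v huv h).mul_left (hmix _ _ huv.symm).symm
    · exact (hinl u v huv h).mul_right (hmix _ _ huv)
    · exact hinl u v huv h
  suffices h : ∃ φ : D →* _, ∀ v, φ (ds.gen v) = g v by
    obtain ⟨φ, hφ⟩ := h
    refine ⟨φ, fun v hv => ?_, fun u => ?_⟩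
    · rw [hφ]
      exact dif_neg hv
    · rw [hφ]
      exact dif_pos u.2
  refine ds.exists_lift g ?_ ?_
  · intro v k hk
    have hk2 : 2 ≤ k := by
      have := M.two_le v v
      rw [hk] at this
      exact_mod_cast this
    simp only [g]
    split_ifs with h
    · refine isCosineMatrix_extGram.reflection_mul_pow hk2 ?_
      simp [extGram, hk]
    · have h2 := entry_eq_two h
      rw [hk] at h2
      obtain rfl : k = 2 := by exact_mod_cast h2
      rw [sq]
      exact isCosineMatrix_extGram.reflection_mul_self _
  · intro u v k huv hk
    have hk2 : 2 ≤ k := by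
      have := M.two_le u v
      rw [hk] at this
      exact_mod_cast this
    have hbig : 3 ≤ M.entry u u ∨ 3 ≤ M.entry v v → k = 2 := by
      rintro (h | h)
      · have := M.eq_two_or_top u v huv h
        rw [hk] at this
        rcases this with h | h
        · exact_mod_cast h
        · simp at h
      · have := M.eq_two_or_top v u huv.symm h
        rw [M.symm, hk] at this
        rcases this with h | h
        · exact_mod_cast h
        · simp at h
    by_cases h : 3 ≤ M.entry u u ∨ 3 ≤ M.entry v v
    · obtain rfl := hbig h
      exact altProd_two_comm (hcomm u v huv hk)
    · push Not at h
      simp only [g, h.1, h.2, dif_neg, not_le]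
      refine altProd_comm_of_mul_pow_eq_one (isCosineMatrix_extGram.reflection_mul_self _)
        (isCosineMatrix_extGram.reflection_mul_self _)
        (isCosineMatrix_extGram.reflection_mul_pow hk2 ?_)
      simp [extGram, huv, hk]

/-- The reflections adjoined to a Dyer group act through finitely many transformations. -/
theorem exists_finite_stable : ∃ Q : Set ((V ⊕ {u // 3 ≤ M.entry u u} → ℝ) ≃ₗ[ℝ]
      (V ⊕ {u // 3 ≤ M.entry u u} → ℝ)), Q.Finite ∧ 1 ∈ Q ∧
    ∀ u, ∀ q ∈ Q, isCosineMatrix_extGram.reflection (.inr u) * q ∈ Q := by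
  classical
  -- Each adjoined reflection alters only its own coordinate, using the coordinate of its partner
  -- vertex. `T ε` applies those with `ε u = true`.
  let T : ({u // 3 ≤ M.entry u u} → Bool) → (V ⊕ {u // 3 ≤ M.entry u u} → ℝ) →
      (V ⊕ {u // 3 ≤ M.entry u u} → ℝ) := fun ε x => Sum.elim (fun v => x (.inl v)) fun u =>
    if ε u then 2 * cosEntry (M.entry u u) * x (.inl u.1) - x (.inr u) else x (.inr u)
  refine ⟨{g | ∃ ε, ⇑g = T ε}, ?_, ⟨fun _ => false, ?_⟩, ?_⟩
  · refine Set.Finite.of_finite_image (f := fun g => ⇑g) ((Set.finite_range T).subset ?_)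
      DFunLike.coe_injective.injOn
    rintro _ ⟨g, ⟨ε, hε⟩, rfl⟩
    exact ⟨ε, hε.symm⟩
  · ext x (v | u) <;> simp [T]
  · rintro u q ⟨ε, hε⟩
    refine ⟨Function.update ε u (!ε u), ?_⟩
    ext x i
    have hform : ∀ y, gramForm M.extGram (Pi.single (.inr u) 1) y =
        y (.inr u) - cosEntry (M.entry u u) * y (.inl u.1) := by
      intro y
      rw [gramForm_comm isCosineMatrix_extGram.symm, gramForm_eq_sum]
      simp only [gramForm_single_single, Fintype.sum_sum_type, extGram, mul_ite, mul_one,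
        mul_zero, Finset.sum_ite_eq', Finset.mem_univ, if_true]
      ring
    rw [LinearEquiv.mul_apply, IsCosineMatrix.reflection_apply, hform, hε]
    rcases i with v | w
    · simp [T]
    · by_cases hw : w = u
      · subst hw
        cases h : ε w <;> simp [T, h] <;> ring
      · simp [T, hw]

/-- Conjugation by an adjoined reflection fixes or inverts the image of each Dyer generator, hence
permits moving that reflection past the image of a ball without increasing word length. Every
element of a ball of the reflection group is therefore the image of an element of the ball of `D` of
the same radius, times one of finitely many transformations in `Q`. -/
theorem growthFunction_reflection_le : ∃ C : ℕ, ∀ m,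
    growthFunction (isCosineMatrix_extGram (M := M)).reflection m ≤
      C * growthFunction ds.gen m := by
  obtain ⟨φ, hφ, hφ'⟩ := ds.exists_reflection_hom
  obtain ⟨Q, hQ, hQ1, hQm⟩ := exists_finite_stable (M := M)
  set r := (isCosineMatrix_extGram (M := M)).reflection with hr
  have hconj : ∀ u v, r (.inr u) * φ (ds.gen v) = φ (ds.gen v) * r (.inr u) ∨
      r (.inr u) * φ (ds.gen v) = φ (ds.gen v)⁻¹ * r (.inr u) := by
    intro u v
    by_cases huv : v = u.1
    · right
      rw [huv, map_inv, hφ', mul_inv_rev]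
      simp only [hr, isCosineMatrix_extGram.reflection_inv, mul_assoc]
    · left
      have h1 : Commute (r (.inr u)) (r (.inl v)) :=
        isCosineMatrix_extGram.commute_reflection (by simp [extGram, huv])
      by_cases hv : 3 ≤ M.entry v v
      · rw [hφ' ⟨v, hv⟩]
        refine h1.mul_right (isCosineMatrix_extGram.commute_reflection ?_)
        have : u ≠ ⟨v, hv⟩ := fun h => huv (by rw [h])
        simp [extGram, this]
      · rw [hφ v hv]
        exact h1
  have hmove : ∀ u m, ∀ d ∈ wordBall ds.gen m, ∃ d' ∈ wordBall ds.gen m,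
      r (.inr u) * φ d = φ d' * r (.inr u) := by
    intro u m d hd
    refine wordBall_induction (P := fun m d => ∃ d' ∈ wordBall ds.gen m,
      r (.inr u) * φ d = φ d' * r (.inr u)) ?_ ?_ ?_ hd
    · exact fun m => ⟨1, one_mem_wordBall m, by simp⟩
    · rintro m v x ⟨d', hd', h⟩
      rw [add_comm]
      rcases hconj u v with hc | hc
      · exact ⟨_, mul_mem_wordBall (gen_mem_wordBall v) hd', by
          rw [map_mul, map_mul, ← mul_assoc, hc, mul_assoc, h, mul_assoc]⟩
      · exact ⟨_, mul_mem_wordBall (gen_inv_mem_wordBall v) hd', by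
          rw [map_mul, map_mul, ← mul_assoc, hc, mul_assoc, h, mul_assoc]⟩
    · rintro m v x ⟨d', hd', h⟩
      rw [add_comm]
      rcases hconj u v with hc | hc
      · refine ⟨_, mul_mem_wordBall (gen_inv_mem_wordBall v) hd', ?_⟩
        have hc' : r (.inr u) * φ (ds.gen v)⁻¹ = φ (ds.gen v)⁻¹ * r (.inr u) := by
          rw [map_inv, eq_inv_mul_iff_mul_eq, ← mul_assoc, ← hc, mul_inv_cancel_right]
        rw [map_mul, map_mul, ← mul_assoc, hc', mul_assoc, h, mul_assoc]
      · refine ⟨_, mul_mem_wordBall (gen_mem_wordBall v) hd', ?_⟩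
        have hc' : r (.inr u) * φ (ds.gen v)⁻¹ = φ (ds.gen v) * r (.inr u) := by
          rw [map_inv, mul_inv_eq_iff_eq_mul, mul_assoc, hc, map_inv, mul_inv_cancel_left]
        rw [map_mul, map_mul, ← mul_assoc, hc', mul_assoc, h, mul_assoc]
  have hstep : ∀ i m, ∀ d ∈ wordBall ds.gen m, ∀ q ∈ Q,
      ∃ d' ∈ wordBall ds.gen (m + 1), ∃ q' ∈ Q, r i * (φ d * q) = φ d' * q' := by
    rintro (v | u) m d hd q hq
    · by_cases hv : 3 ≤ M.entry v v
      · obtain ⟨d', hd', h⟩ := hmove ⟨v, hv⟩ m d hd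
        refine ⟨ds.gen v * d', ?_, _, hQm ⟨v, hv⟩ q hq, ?_⟩
        · rw [add_comm]
          exact mul_mem_wordBall (gen_mem_wordBall v) hd'
        · have h1 : r (.inl v) = φ (ds.gen v) * r (.inr ⟨v, hv⟩) := by
            rw [hφ' ⟨v, hv⟩, mul_assoc]
            simp only [isCosineMatrix_extGram.reflection_mul_self, mul_one, hr]
          rw [map_mul, h1, mul_assoc, mul_assoc, ← mul_assoc _ (φ d) q, h, mul_assoc]
      · refine ⟨ds.gen v * d, ?_, q, hq, ?_⟩
        · rw [add_comm]
          exact mul_mem_wordBall (gen_mem_wordBall v) hd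
        · rw [map_mul, hφ v hv, mul_assoc]
    · obtain ⟨d', hd', h⟩ := hmove u m d hd
      exact ⟨d', wordBall_mono (Nat.le_succ m) hd', _, hQm u q hq, by
        rw [← mul_assoc, h, mul_assoc]⟩
  refine ⟨Q.ncard, fun m => ?_⟩
  have hfin := hQ.prod (finite_wordBall ds.gen m)
  rw [growthFunction, growthFunction, ← Set.ncard_prod]
  refine (Set.ncard_le_ncard (t := (fun p => φ p.2 * p.1) '' (Q ×ˢ wordBall ds.gen m))
    (fun x hx => ?_) (hfin.image _)).trans (Set.ncard_image_le hfin)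
  have key : ∃ d ∈ wordBall ds.gen m, ∃ q ∈ Q, x = φ d * q := by
    refine wordBall_induction (P := fun m x => ∃ d ∈ wordBall ds.gen m, ∃ q ∈ Q, x = φ d * q)
      ?_ ?_ ?_ hx
    · exact fun m => ⟨1, one_mem_wordBall m, 1, hQ1, by simp⟩
    · rintro m i x ⟨d, hd, q, hq, rfl⟩
      exact hstep i m d hd q hq
    · rintro m i x ⟨d, hd, q, hq, rfl⟩
      rw [isCosineMatrix_extGram.reflection_inv]
      exact hstep i m d hd q hq
  obtain ⟨d, hd, q, hq, rfl⟩ := key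
  exact ⟨(q, d), ⟨hq, hd⟩, rfl⟩

/-- If a Dyer group has growth rate `1`, its extended cosine matrix is positive semidefinite. -/
theorem gramForm_nonneg_of_growthRate_eq_one (h : growthRate ds.gen = 1)
    (x : V ⊕ {u // 3 ≤ M.entry u u} → ℝ) : 0 ≤ gramForm M.extGram x x := by
  by_contra! hx
  obtain ⟨N, hN⟩ := exists_exponential_family isCosineMatrix_extGram ⟨x, hx⟩
  obtain ⟨C, hC⟩ := ds.growthFunction_reflection_le
  exact growthRate_ne_one_of_exponential ds.gen (fun m => (hN m).trans (hC _)) h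

/-- An edge at `u` has exponent `∞`, and the test vector then has square `1/4 - cos (π / f_u) ≤ 1/4
- 1/2` (cosine read as 1 for infinite order). -/
theorem not_adj_of_growthRate_eq_one (h : growthRate ds.gen = 1) (u v : V)
    (hu : 3 ≤ M.entry u u) : ¬ M.graph.Adj u v := by
  rintro ⟨huv, h3⟩
  have htop : M.entry u v = ⊤ := by
    refine (M.eq_two_or_top u v huv hu).resolve_left fun h2 => ?_
    rw [h2] at h3
    norm_num at h3
  have h1 := ds.gramForm_nonneg_of_growthRate_eq_one h
    (Pi.single (.inl u) 1 + Pi.single (.inl v) 1 + (1 / 2 : ℝ) • Pi.single (.inr ⟨u, hu⟩) 1)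
  have h2 := half_le_cosEntry hu
  simp only [map_add, map_smul, LinearMap.add_apply, LinearMap.smul_apply, smul_eq_mul,
    gramForm_single_single, extGram, huv, huv.symm, if_true, if_false, M.symm v u, htop,
    cosEntry_top] at h1
  linarith

theorem gramForm_involution_nonneg_of_growthRate_eq_one (h : growthRate ds.gen = 1)
    [Fintype {v // M.entry v v = 2}] (x : {v // M.entry v v = 2} → ℝ) :
    0 ≤ gramForm (M.extGram.submatrix (fun v : {v // M.entry v v = 2} => .inl v.1)
      (fun v : {v // M.entry v v = 2} => .inl v.1)) x x := by
  have := gramForm_submatrix M.extGram (Sum.inl_injective.comp Subtype.val_injective)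
    (f := Sum.inl ∘ (Subtype.val : {v // M.entry v v = 2} → V)) x x
  exact (ds.gramForm_nonneg_of_growthRate_eq_one h _).trans_eq this

end DyerSystem

/-! ### Tits' theorem on the contragredient reflection representation -/

section Length

variable {ι W : Type*} [Group W] {t : ι → W}

/-- The word length with respect to the family `t`. -/
noncomputable def wordLength (t : ι → W) (w : W) : ℕ := sInf {n | w ∈ wordBall t n}

theorem wordLength_le {w : W} {n : ℕ} (h : w ∈ wordBall t n) : wordLength t w ≤ n := Nat.sInf_le h

variable (ht : Subgroup.closure (Set.range t) = ⊤)

include ht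

theorem mem_wordBall_wordLength (w : W) : w ∈ wordBall t (wordLength t w) :=
  Nat.sInf_mem (s := {n | w ∈ wordBall t n}) (exists_mem_wordBall (ht.ge (Subgroup.mem_top w)))

theorem wordLength_gen_mul_le (i : ι) (w : W) :
    wordLength t (t i * w) ≤ wordLength t w + 1 := by
  rw [add_comm]
  exact wordLength_le (mul_mem_wordBall (gen_mem_wordBall i) (mem_wordBall_wordLength ht w))

variable (hinv : ∀ i, t i * t i = 1)

include hinv

theorem exists_wordLength_gen_mul_lt {w : W} (hw : w ≠ 1) :
    ∃ i, wordLength t (t i * w) < wordLength t w := by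
  obtain ⟨l, hl, hg, hlw⟩ := mem_wordBall_wordLength ht w
  match l, hl, hg, hlw with
  | [], _, _, hlw => exact absurd hlw.symm hw
  | a :: l, hl, hg, hlw =>
    obtain ⟨i, hi⟩ := hg a (by simp)
    have ha : a = t i := by
      rcases hi with h | h
      · exact h
      · rw [h, inv_eq_of_mul_eq_one_left (hinv i)]
    refine ⟨i, ?_⟩
    have h1 : t i * w = l.prod := by
      rw [← hlw, List.prod_cons, ha, ← mul_assoc, hinv, one_mul]
    rw [h1]
    have h2 : wordLength t l.prod ≤ l.length :=
      wordLength_le ⟨l, le_rfl, fun g h => hg g (by simp [h]), rfl⟩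
    simp at hl
    omega

omit hinv in
theorem map_sign_eq_pow_wordLength {σ : W →* ℤˣ} (hσ : ∀ i, σ (t i) = -1) (w : W) :
    σ w = (-1) ^ wordLength t w := by
  obtain ⟨l, hl, hg, hlw⟩ := mem_wordBall_wordLength ht w
  have h1 : wordLength t w ≤ l.length := wordLength_le ⟨l, le_rfl, hg, hlw⟩
  rw [le_antisymm h1 hl, ← hlw]
  clear h1 hl hlw
  induction l with
  | nil => simp
  | cons a l ih =>
    have h2 : σ a = -1 := by
      obtain ⟨i, rfl | rfl⟩ := hg a (by simp)
      · exact hσ i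
      · rw [map_inv, hσ]
        rfl
    rw [List.prod_cons, map_mul, ih fun g h => hg g (by simp [h]), h2, List.length_cons, pow_succ']

/-- The lengths differ by at most 1, and the sign character, which records length parity, excludes
equality. -/
theorem wordLength_gen_mul_eq {σ : W →* ℤˣ} (hσ : ∀ i, σ (t i) = -1) (i : ι) (w : W) :
    wordLength t (t i * w) = wordLength t w + 1 ∨ wordLength t w = wordLength t (t i * w) + 1 := by
  have h1 := wordLength_gen_mul_le ht i w
  have h2 := wordLength_gen_mul_le ht i (t i * w)
  rw [← mul_assoc, hinv, one_mul] at h2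
  have h3 : wordLength t (t i * w) ≠ wordLength t w := by
    intro h
    have h4 := map_sign_eq_pow_wordLength ht hσ (t i * w)
    rw [h, map_mul, hσ, map_sign_eq_pow_wordLength ht hσ w, neg_one_mul] at h4
    rcases neg_one_pow_eq_or ℤˣ (wordLength t w) with h5 | h5 <;> rw [h5] at h4 <;>
      exact absurd h4 (by decide)
  omega

/-- Stripping an alternating prefix in two generators from an element. -/
theorem exists_altProd_mul {σ : W →* ℤˣ} (hσ : ∀ i, σ (t i) = -1) (i j : ι) (w : W)
    (h : wordLength t w < wordLength t (t i * w)) :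
    ∃ k v, w = altProd (t j) (t i) k * v ∧ wordLength t w = wordLength t v + k ∧
      wordLength t v < wordLength t (t i * v) ∧ wordLength t v < wordLength t (t j * v) := by
  induction hn : wordLength t w generalizing i j w with
  | zero =>
    refine ⟨0, w, by simp [altProd], by omega, h, ?_⟩
    have := wordLength_gen_mul_eq ht hinv hσ j w
    omega
  | succ n ih =>
    rcases wordLength_gen_mul_eq ht hinv hσ j w with hj | hj
    · exact ⟨0, w, by simp [altProd], by omega, h, by omega⟩
    · have hjj : t j * (t j * w) = w := by rw [← mul_assoc, hinv, one_mul]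
      -- The roles of `i` and `j` swap: `t j` lengthens `t j * w` back to `w`.
      obtain ⟨k, v, h1, h2, h3, h4⟩ := ih j i (t j * w) (by rw [hjj]; omega) (by omega)
      exact ⟨k + 1, v, by rw [altProd, mul_assoc, ← h1, hjj], by omega, h4, h3⟩

omit ht hinv in
theorem altProd_mem_wordBall (i j : ι) (k : ℕ) : altProd (t i) (t j) k ∈ wordBall t k := by
  induction k generalizing i j with
  | zero => exact one_mem_wordBall 0
  | succ k ih =>
    have := mul_mem_wordBall (gen_mem_wordBall i) (ih j i)
    rwa [add_comm] at this

omit ht hinv in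
theorem exists_altProd_add (i j : ι) (n k : ℕ) :
    ∃ z ∈ wordBall t k, altProd (t i) (t j) (n + k) = altProd (t i) (t j) n * z := by
  induction n generalizing i j with
  | zero => exact ⟨_, altProd_mem_wordBall i j k, by simp [altProd]⟩
  | succ n ih =>
    obtain ⟨z, hz, h⟩ := ih j i
    exact ⟨z, hz, by rw [Nat.succ_add, altProd, h, altProd, mul_assoc]⟩

end Length

/-- For finite `m` take `q k = sin (kπ / m) / sin (π / m)`, which is positive before `k = m` and
vanishes there; for `m = ∞` take its limit `q k = k`. -/
theorem exists_chebyshev_sequence {m : ℕ∞} (hm : 2 ≤ m) : ∃ q : ℕ → ℝ, q 1 = 1 ∧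
    q 2 = 2 * cosEntry m ∧ (∀ k, q (k + 2) = 2 * cosEntry m * q (k + 1) - q k) ∧
    (∀ k : ℕ, 0 < k → (k : ℕ∞) < m → 0 < q k) ∧ ∀ k : ℕ, (k : ℕ∞) ≤ m → 0 ≤ q k := by
  induction m with
  | top =>
    refine ⟨fun k => k, by simp, by simp [cosEntry_top], fun k => ?_, fun k hk _ => ?_,
      fun k _ => by positivity⟩
    · push_cast
      rw [cosEntry_top]
      ring
    · exact Nat.cast_pos.2 hk
  | coe n =>
    have hn : 2 ≤ n := by exact_mod_cast hm
    have hn' : (2 : ℝ) ≤ n := by exact_mod_cast hn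
    have hπ := Real.pi_pos
    have hle : Real.pi / n < Real.pi := by
      rw [div_lt_iff₀ (by linarith)]
      nlinarith
    have hsin : 0 < Real.sin (Real.pi / n) := Real.sin_pos_of_pos_of_lt_pi (by positivity) hle
    refine ⟨fun k => Real.sin (k * (Real.pi / n)) / Real.sin (Real.pi / n), ?_, ?_, fun k => ?_,
      fun k hk hkn => ?_, fun k hkn => ?_⟩
    · beta_reduce
      rw [Nat.cast_one, one_mul, div_self hsin.ne']
    · beta_reduce
      rw [cosEntry_coe, Nat.cast_ofNat, Real.sin_two_mul]
      field_simp
    · rw [cosEntry_coe, mul_div_assoc', ← sub_div]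
      push_cast
      rw [show ((k : ℝ) + 2) * (Real.pi / n) = (k + 1) * (Real.pi / n) + Real.pi / n by ring,
        show (k : ℝ) * (Real.pi / n) = (k + 1) * (Real.pi / n) - Real.pi / n by ring,
        Real.sin_add, Real.sin_sub]
      ring
    · have hkn' : (k : ℝ) < n := by exact_mod_cast hkn
      have hk' : (0 : ℝ) < k := by exact_mod_cast hk
      refine div_pos (Real.sin_pos_of_pos_of_lt_pi (by positivity) ?_) hsin
      rw [mul_div_assoc', div_lt_iff₀ (by linarith)]
      nlinarith
    · have hkn' : (k : ℝ) ≤ n := by exact_mod_cast hkn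
      refine div_nonneg (Real.sin_nonneg_of_nonneg_of_le_pi (by positivity) ?_) hsin.le
      rw [mul_div_assoc', div_le_iff₀ (by linarith)]
      nlinarith

/-! ### Sides of walls: the dihedral computation and the induction on length. -/

section Tits

variable {ι W : Type*} [Group W] {t : ι → W} {m : ι → ι → ℕ∞} {B : ι → ι → ℝ} {g : W → ι → ℝ}

/-- This is the rank-two case. The family `g` abstracts the values of the simple wall functionals on
an orbit, so that the same argument covers affine actions. -/
theorem apply_altProd_mul_pos (hB : ∀ i, B i i = 1)
    (hg : ∀ i w j, g (t i * w) j = g w j - 2 * B i j * g w i) {i j : ι} {c : ℕ∞} (hc : 2 ≤ c)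
    (hij : B i j = -cosEntry c) (hji : B j i = -cosEntry c) {v : W} (hi : 0 < g v i)
    (hj : 0 < g v j) {k : ℕ} (hk : (k : ℕ∞) + 1 ≤ c) :
    0 < g (altProd (t j) (t i) k * v) i := by
  obtain ⟨q, q1, q2, qrec, qpos, qnonneg⟩ := exists_chebyshev_sequence hc
  have hself : ∀ i w, g (t i * w) i = -g w i := fun i w => by
    rw [hg, hB]
    ring
  -- A discrete Wronskian: the values along the alternating product obey the recurrence of `q`, so
  -- this expression is unchanged from `k` to `k + 1` up to exchanging `i` and `j`. For `k = 0` it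
  -- equals `g v i`.
  have hcas : ∀ k, ∀ i j, B i j = -cosEntry c → B j i = -cosEntry c → 0 < g v i → 0 < g v j →
      0 < q (k + 1) * g (altProd (t j) (t i) (k + 1) * v) i -
        q (k + 2) * g (altProd (t i) (t j) k * v) j := by
    intro k
    induction k with
    | zero =>
      intro i j hij hji hi hj
      simp only [altProd, mul_one, one_mul, hg, hji, zero_add, q1, q2]
      linarith
    | succ k ih =>
      intro i j hij hji hi hj
      have h1 := ih j i hji hij hj hi
      have h2 : g (altProd (t j) (t i) (k + 1 + 1) * v) i =
          2 * cosEntry c * g (altProd (t i) (t j) (k + 1) * v) j -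
            g (altProd (t j) (t i) k * v) i := by
        rw [altProd, mul_assoc, hg, hji, altProd, mul_assoc, hself]
        ring
      rw [h2, qrec (k + 1)]
      linarith
  have hmain : ∀ k : ℕ, (k : ℕ∞) + 1 ≤ c → ∀ i j, B i j = -cosEntry c → B j i = -cosEntry c →
      0 < g v i → 0 < g v j → 0 < g (altProd (t j) (t i) k * v) i := by
    intro k
    induction k with
    | zero =>
      intro _ i j _ _ hi _
      simpa [altProd] using hi
    | succ k ih =>
      intro hk i j hij hji hi hj
      have hk1 : (k : ℕ∞) + 1 ≤ c := le_trans (by exact_mod_cast Nat.le_succ _) hk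
      have h1 := ih hk1 j i hji hij hj hi
      have h2 := hcas k i j hij hji hi hj
      have h3 : 0 < q (k + 1) := by
        refine qpos _ (Nat.succ_pos k) (lt_of_lt_of_le ?_ hk)
        exact_mod_cast Nat.lt_succ_self _
      have h4 : 0 ≤ q (k + 2) := qnonneg _ (by exact_mod_cast hk)
      have h5 := mul_nonneg h4 h1.le
      by_contra! hcon
      nlinarith
  exact hmain k hk i j hij hji hi hj

variable (ht : Subgroup.closure (Set.range t) = ⊤) (hinv : ∀ i, t i * t i = 1)
  {σ : W →* ℤˣ} (hσ : ∀ i, σ (t i) = -1) (hm : ∀ i j, 2 ≤ m i j) (hsymm : ∀ i j, m i j = m j i)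
  (hrel : ∀ i j (k : ℕ), i ≠ j → m i j = k → altProd (t i) (t j) k = altProd (t j) (t i) k)
  (hB : ∀ i, B i i = 1) (hB' : ∀ i j, i ≠ j → B i j = -cosEntry (m i j))
  (hg1 : ∀ i, 0 < g 1 i) (hg : ∀ i w j, g (t i * w) j = g w j - 2 * B i j * g w i)

include ht hinv hσ hm hsymm hrel hB hB' hg1 hg

/-- Tits: the translates of the open fundamental chamber lie on the sides of the walls prescribed
by the word length. -/
theorem apply_pos_of_wordLength_lt (w : W) (i : ι)
    (h : wordLength t w < wordLength t (t i * w)) : 0 < g w i := by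
  induction hn : wordLength t w using Nat.strong_induction_on generalizing w i with
  | _ n ih =>
    subst hn
    by_cases hw : w = 1
    · rw [hw]
      exact hg1 i
    obtain ⟨j, hj⟩ := exists_wordLength_gen_mul_lt ht hinv hw
    have hij : i ≠ j := by
      rintro rfl
      omega
    obtain ⟨k, v, hwv, hlen, hi, hj'⟩ := exists_altProd_mul ht hinv hσ i j w h
    have hk : k ≠ 0 := by
      rintro rfl
      rw [altProd, one_mul] at hwv
      subst hwv
      omega
    have hvi := ih (wordLength t v) (by omega) v i hi rfl
    have hvj := ih (wordLength t v) (by omega) v j hj' rfl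
    rw [hwv]
    refine apply_altProd_mul_pos hB hg (hm i j) (hB' i j hij)
      (by rw [hB' j i hij.symm, hsymm]) hvi hvj ?_
    -- A stripped prefix of length at least `m i j` could be rewritten by the braid relation to
    -- start with `t i`. Cancelling that letter would make `t i * w` shorter than `w`.
    by_contra hcon
    obtain ⟨n, hn⟩ : ∃ n : ℕ, m i j = n := by
      have hne : m i j ≠ ⊤ := fun htop => hcon (by rw [htop]; exact le_top)
      obtain ⟨n, hn⟩ := ENat.ne_top_iff_exists.1 hne
      exact ⟨n, hn.symm⟩
    have hn2 := hm i j
    rw [hn] at hcon hn2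
    have hnk : n ≤ k := by
      by_contra! hlt
      exact hcon (by exact_mod_cast hlt)
    obtain ⟨n, rfl⟩ : ∃ n', n = n' + 1 := ⟨n - 1, by
      have : 2 ≤ n := by exact_mod_cast hn2
      omega⟩
    obtain ⟨p, rfl⟩ := Nat.exists_eq_add_of_le hnk
    obtain ⟨z, hz, hzeq⟩ := exists_altProd_add (t := t) j i (n + 1) p
    have h1 : t i * w = altProd (t j) (t i) n * z * v := by
      rw [hwv, hzeq, ← hrel i j (n + 1) hij hn, altProd, ← mul_assoc, ← mul_assoc, ← mul_assoc,
        hinv, one_mul]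
    have h2 : wordLength t (t i * w) ≤ n + p + wordLength t v := by
      rw [h1]
      exact wordLength_le (mul_mem_wordBall (mul_mem_wordBall (altProd_mem_wordBall j i n) hz)
        (mem_wordBall_wordLength ht v))
    omega

theorem exists_apply_neg {w : W} (hw : w ≠ 1) : ∃ i, g w i < 0 := by
  obtain ⟨i, hi⟩ := exists_wordLength_gen_mul_lt ht hinv hw
  refine ⟨i, ?_⟩
  have hii : t i * (t i * w) = w := by rw [← mul_assoc, hinv, one_mul]
  have h1 := apply_pos_of_wordLength_lt ht hinv hσ hm hsymm hrel hB hB' hg1 hg (t i * w) i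
    (by rw [hii]; exact hi)
  have h2 := hg i (t i * w) i
  rw [hii, hB] at h2
  linarith

end Tits

/-! ### Affine reflections with prescribed Gram matrix -/

section AffineReflection

open scoped InnerProductSpace

variable {E : Type*} [NormedAddCommGroup E] [InnerProductSpace ℝ E]

/-- The reflection in the affine hyperplane orthogonal to `a` through `p`. -/
noncomputable def affineReflection (a p : E) : E ≃ᵢ E :=
  IsometryEquiv.mk' (fun x => p + (Submodule.span ℝ {a})ᗮ.reflection (x - p))
    (fun x => p + (Submodule.span ℝ {a})ᗮ.reflection (x - p))
    (fun x => by simp) (by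
      refine Isometry.of_dist_eq fun x y => ?_
      rw [dist_add_left, LinearIsometryEquiv.dist_map, dist_sub_right])

theorem affineReflection_apply (a p x : E) :
    affineReflection a p x = p + (Submodule.span ℝ {a})ᗮ.reflection (x - p) := rfl

theorem affineReflection_eq {a : E} (ha : ⟪a, a⟫_ℝ = 1) (c : ℝ) (x : E) :
    affineReflection a (-c • a) x = x - (2 * (⟪a, x⟫_ℝ + c)) • a := by
  have hnorm : ‖a‖ = 1 := by
    rw [real_inner_self_eq_norm_sq] at ha
    nlinarith [norm_nonneg a]
  rw [affineReflection_apply, Submodule.reflection_orthogonal_apply,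
    Submodule.reflection_singleton_apply]
  simp only [inner_sub_right, inner_smul_right, ha, hnorm]
  simp
  module

theorem affineReflection_mul_self (a p : E) : affineReflection a p * affineReflection a p = 1 := by
  ext x
  simp [affineReflection_apply, IsometryEquiv.mul_apply]

/-- The linear functional on `E × ℝ` extending an affine functional on `E`. -/
noncomputable def liftedFunctional (a : E) (c : ℝ) : Module.Dual ℝ (E × ℝ) :=
  (2 : ℝ) • ((innerₗ E a).comp (LinearMap.fst ℝ E ℝ) + c • LinearMap.snd ℝ E ℝ)

theorem liftedFunctional_apply (a : E) (c : ℝ) (x : E) (s : ℝ) :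
    liftedFunctional a c (x, s) = 2 * (⟪a, x⟫_ℝ + c * s) := rfl

/-- On the slice `E × {1}` of `E × ℝ` the affine reflections become linear ones with roots `(a, 0)`
and `(b, 0)`, and the linear statement applies. -/
theorem affineReflection_mul_pow {a b : E} (ha : ⟪a, a⟫_ℝ = 1) (hb : ⟪b, b⟫_ℝ = 1) (c : ℝ)
    {k : ℕ} (hk : 2 ≤ k) (hab : ⟪a, b⟫_ℝ = -cosEntry k) :
    (affineReflection a (-c • a) * affineReflection b (-c • b)) ^ k = 1 := by
  have h2 : ∀ {a : E}, ⟪a, a⟫_ℝ = 1 → liftedFunctional a c (a, 0) = 2 := fun h => by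
    rw [liftedFunctional_apply, h]
    norm_num
  rw [cosEntry_coe] at hab
  have h1 := reflection_mul_reflection_pow_eq_one (h2 ha) (h2 hb) hk
    (by rw [liftedFunctional_apply, hab]; ring)
    (by rw [liftedFunctional_apply, real_inner_comm, hab]; ring)
  have hstep : ∀ {a : E} (h : ⟪a, a⟫_ℝ = 1) (x : E), Module.reflection (h2 h) (x, 1) =
      (affineReflection a (-c • a) x, (1 : ℝ)) := fun {a} h x => by
    rw [Module.reflection_apply, liftedFunctional_apply, affineReflection_eq h, mul_one]
    ext <;> simp
  have hpow : ∀ (n : ℕ) (x : E),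
      ((Module.reflection (h2 ha) * Module.reflection (h2 hb)) ^ n) (x, (1 : ℝ)) =
        (((affineReflection a (-c • a) * affineReflection b (-c • b)) ^ n) x, (1 : ℝ)) := by
    intro n
    induction n with
    | zero => exact fun x => rfl
    | succ n ih =>
      intro x
      rw [pow_succ, pow_succ, LinearEquiv.mul_apply, LinearEquiv.mul_apply, hstep hb, hstep ha, ih]
      rfl
  ext x
  have h3 := hpow k x
  rw [h1] at h3
  exact (congrArg Prod.fst h3).symm

end AffineReflection

/-! ### Grid cells in Euclidean space -/

section Grid

/-- The cell of side `1 / (d + 1)` containing a point of `𝔼^d`. -/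
noncomputable def gridCell {d : ℕ} (x : EucSpace d) : Fin d → ℤ := fun j => ⌊((d : ℝ) + 1) * x j⌋

/-- A cell of side `1 / (d + 1)` has diagonal `√d / (d + 1) < 1`, including the case `d = 0`. -/
theorem dist_lt_one_of_gridCell_eq {d : ℕ} {x y : EucSpace d} (h : gridCell x = gridCell y) :
    dist x y < 1 := by
  have hd : (0 : ℝ) < d + 1 := by positivity
  have hj : ∀ j, dist (x j) (y j) ^ 2 ≤ (1 / (d + 1)) ^ 2 := by
    intro j
    have h1 := Int.abs_sub_lt_one_of_floor_eq_floor (congrFun h j)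
    rw [← mul_sub, abs_mul, abs_of_pos hd] at h1
    rw [Real.dist_eq]
    gcongr
    rw [le_div_iff₀ hd]
    linarith
  rw [EuclideanSpace.dist_eq, Real.sqrt_lt' one_pos]
  calc ∑ j, dist (x j) (y j) ^ 2 ≤ ∑ _j : Fin d, (1 / ((d : ℝ) + 1)) ^ 2 :=
        Finset.sum_le_sum fun j _ => hj j
    _ = d / (d + 1) ^ 2 := by simp [div_eq_mul_inv]
    _ < 1 ^ 2 := by
        rw [div_lt_iff₀ (by positivity)]
        nlinarith

theorem gridCell_mem {d R : ℕ} {x : EucSpace d} (h : ‖x‖ ≤ R) :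
    gridCell x ∈ Fintype.piFinset fun _ : Fin d =>
      Finset.Icc (-(((d + 1) * R : ℕ) : ℤ)) ((d + 1) * R : ℕ) := by
  rw [Fintype.mem_piFinset]
  intro j
  have h1 := (PiLp.norm_apply_le x j).trans h
  rw [Real.norm_eq_abs, abs_le] at h1
  have hd : (0 : ℝ) < d + 1 := by positivity
  rw [Finset.mem_Icc, gridCell]
  constructor
  · rw [Int.le_floor]
    push_cast
    nlinarith
  · have : ((⌊((d : ℝ) + 1) * x j⌋ : ℤ) : ℝ) ≤ (((d + 1) * R : ℕ) : ℤ) := by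
      refine (Int.floor_le _).trans ?_
      push_cast
      nlinarith
    exact_mod_cast this

theorem card_gridCells (d R : ℕ) : (Fintype.piFinset fun _ : Fin d =>
    Finset.Icc (-(((d + 1) * R : ℕ) : ℤ)) ((d + 1) * R : ℕ)).card =
      (2 * ((d + 1) * R) + 1) ^ d := by
  rw [Fintype.card_piFinset, Finset.prod_const, Finset.card_univ, Fintype.card_fin, Int.card_Icc]
  congr 1
  omega

end Grid

/-! ### The Coxeter subgroup of a Dyer group -/

namespace DyerSystem

open DyerMatrix
open scoped InnerProductSpace

variable {V : Type*} {M : DyerMatrix V} {D : Type*} [Group D] (ds : DyerSystem M D)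

/-- Instead of a presentation of `D_2`, use that of `D`: send the generators of order other than 2
to 1 and restrict. This respects the relations because every finite braid exponent at such a
generator is 2. -/
theorem exists_involution_hom {G : Type*} [Group G] (g : {v // M.entry v v = 2} → G)
    (h1 : ∀ i, g i * g i = 1)
    (h2 : ∀ (i j : {v // M.entry v v = 2}) (k : ℕ), i ≠ j → M.entry i j = k → 2 ≤ k → (g i * g j) ^ k = 1) :
    ∃ φ : ds.involutionSubgroup →* G, ∀ i, φ (ds.involutionGen i) = g i := by
  classical
  let g' : V → G := fun v => if h : M.entry v v = 2 then g ⟨v, h⟩ else 1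
  have hbig : ∀ u v (k : ℕ), u ≠ v → M.entry u v = k → M.entry u u ≠ 2 → k = 2 := by
    intro u v k huv hk h
    have h3 : 3 ≤ M.entry u u := by
      by_contra h3
      exact h (entry_eq_two h3)
    have := M.eq_two_or_top u v huv h3
    rw [hk] at this
    rcases this with h | h
    · exact_mod_cast h
    · simp at h
  obtain ⟨φ, hφ⟩ : ∃ φ : D →* G, ∀ v, φ (ds.gen v) = g' v := by
    refine ds.exists_lift g' ?_ ?_
    · intro v k hk
      simp only [g']
      split_ifs with h
      · rw [hk] at h
        obtain rfl : k = 2 := by exact_mod_cast h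
        rw [sq, h1]
      · exact one_pow k
    · intro u v k huv hk
      by_cases hu : M.entry u u = 2
      · by_cases hv : M.entry v v = 2
        · have hk2 : 2 ≤ k := by
            have := M.two_le u v
            rw [hk] at this
            exact_mod_cast this
          simp only [g', hu, hv, dif_pos]
          exact altProd_comm_of_mul_pow_eq_one (h1 _) (h1 _)
            (h2 ⟨u, hu⟩ ⟨v, hv⟩ k (by simpa using huv) hk hk2)
        · obtain rfl := hbig v u k huv.symm (by rw [M.symm, hk]) hv
          simp only [g', hv, dif_neg, not_false_eq_true]
          exact (altProd_one_comm _).symm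
      · obtain rfl := hbig u v k huv hk hu
        simp only [g', hu, dif_neg, not_false_eq_true]
        exact altProd_one_comm _
  refine ⟨φ.comp ds.involutionSubgroup.subtype, fun i => ?_⟩
  have : φ (ds.gen i.1) = g i := by rw [hφ]; exact dif_pos i.2
  exact this

theorem involutionGen_mul_self (i : {v // M.entry v v = 2}) :
    ds.involutionGen i * ds.involutionGen i = 1 := Subtype.ext (ds.gen_mul_self i.2)

theorem closure_range_involutionGen :
    Subgroup.closure (Set.range ds.involutionGen) = ⊤ := by
  have h : Set.range ds.involutionGen = (Subtype.val : ds.involutionSubgroup → D) ⁻¹'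
      (ds.gen '' {v | M.entry v v = 2}) := by
    ext x
    constructor
    · rintro ⟨i, rfl⟩
      exact ⟨i, i.2, rfl⟩
    · rintro ⟨v, hv, h⟩
      exact ⟨⟨v, hv⟩, Subtype.ext h⟩
  rw [h]
  exact Subgroup.closure_closure_coe_preimage

theorem altProd_involutionGen {i j : {v // M.entry v v = 2}} (hij : i ≠ j) {k : ℕ}
    (h : M.entry i j = k) : altProd (ds.involutionGen i) (ds.involutionGen j) k =
      altProd (ds.involutionGen j) (ds.involutionGen i) k := by
  refine Subtype.ext ?_
  have h1 := map_altProd ds.involutionSubgroup.subtype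
  simp only [Subgroup.coe_subtype] at h1
  rw [h1, h1]
  exact ds.altProd_gen (Subtype.val_injective.ne hij) h

/-- The cosine matrix of the Coxeter group `D_2`. -/
noncomputable def _root_.DyerMatrix.involutionGram [DecidableEq V] (M : DyerMatrix V) :
    Matrix {v // M.entry v v = 2} {v // M.entry v v = 2} ℝ :=
  M.extGram.submatrix (fun v => .inl v.1) (fun v => .inl v.1)

theorem involutionGram_self [DecidableEq V] (i : {v // M.entry v v = 2}) :
    M.involutionGram i i = 1 := by simp [involutionGram, extGram]

theorem involutionGram_of_ne [DecidableEq V] {i j : {v // M.entry v v = 2}} (h : i ≠ j) :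
    M.involutionGram i j = -cosEntry (M.entry i j) := by
  have : i.1 ≠ j.1 := Subtype.val_injective.ne h
  simp [involutionGram, extGram, this]

theorem involutionGram_symm [DecidableEq V] (i j : {v // M.entry v v = 2}) :
    M.involutionGram i j = M.involutionGram j i :=
  isCosineMatrix_extGram.symm (.inl i.1) (.inl j.1)

theorem exists_vectors [DecidableEq V] [Fintype {v // M.entry v v = 2}]
    (h : ∀ x, 0 ≤ gramForm M.involutionGram x x) :
    ∃ (d : ℕ) (a : {v // M.entry v v = 2} → EuclideanSpace ℝ (Fin (d + 1))),
      ∀ i j, ⟪a i, a j⟫_ℝ = M.involutionGram i j := by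
  have hpos : M.involutionGram.PosSemidef := by
    refine .of_dotProduct_mulVec_nonneg ?_ fun x => ?_
    · ext i j
      rw [Matrix.conjTranspose_apply, star_trivial]
      exact involutionGram_symm _ _
    · have := h x
      rw [gramForm, Matrix.toBilin'_apply'] at this
      simpa using this
  -- A decomposition into rank-one terms gives the coordinates. The extra zero coordinate makes the
  -- dimension `d + 1`, as needed for `𝕊^d`.
  obtain ⟨d, v, hv⟩ := Matrix.posSemidef_iff_eq_sum_vecMulVec.1 hpos
  refine ⟨d, fun i => WithLp.toLp 2 (Fin.cons 0 fun k => v k i), fun i j => ?_⟩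
  rw [hv, PiLp.inner_apply, Fin.sum_univ_succ]
  simp [Matrix.sum_apply, Matrix.vecMulVec_apply, mul_comm]

theorem exists_affine_action [DecidableEq V] {E : Type*} [NormedAddCommGroup E]
    [InnerProductSpace ℝ E] {a : {v // M.entry v v = 2} → E}
    (ha : ∀ i j, ⟪a i, a j⟫_ℝ = M.involutionGram i j) (c : ℝ) :
    ∃ φ : ds.involutionSubgroup →* (E ≃ᵢ E),
      ∀ i, φ (ds.involutionGen i) = affineReflection (a i) (-c • a i) := by
  refine ds.exists_involution_hom _ (fun i => affineReflection_mul_self _ _) ?_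
  intro i j k hij hk hk2
  refine affineReflection_mul_pow ?_ ?_ c hk2 ?_
  · rw [ha, involutionGram_self]
  · rw [ha, involutionGram_self]
  · rw [ha, involutionGram_of_ne hij, hk]

/-- With `c = 0` all walls pass through the origin, so the action restricts to the unit sphere;
finiteness gives proper discontinuity for free. -/
theorem isSphericalCoxeter_of_finite [DecidableEq V] [Finite ds.involutionSubgroup] {d : ℕ}
    {a : {v // M.entry v v = 2} → EuclideanSpace ℝ (Fin (d + 1))}
    (ha : ∀ i j, ⟪a i, a j⟫_ℝ = M.involutionGram i j) : IsSphericalCoxeter ds.involutionGen := by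
  obtain ⟨φ, hφ⟩ := ds.exists_affine_action ha 0
  have hφ' : ∀ i x, φ (ds.involutionGen i) x = (Submodule.span ℝ {a i})ᗮ.reflection x := by
    intro i x
    rw [hφ, affineReflection_apply]
    simp
  have h0 : ∀ w, φ w 0 = 0 := by
    intro w
    obtain ⟨m, hm⟩ := exists_mem_wordBall
      (ds.closure_range_involutionGen.ge (Subgroup.mem_top w))
    refine wordBall_induction (P := fun _ w => φ w 0 = 0) ?_ ?_ ?_ hm
    · exact fun m => by rw [map_one]; rfl
    · intro m i x hx
      rw [map_mul, IsometryEquiv.mul_apply, hx, hφ', map_zero]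
    · intro m i x hx
      rw [inv_eq_of_mul_eq_one_left (ds.involutionGen_mul_self i), map_mul,
        IsometryEquiv.mul_apply, hx, hφ', map_zero]
  have hnorm : ∀ w x, ‖φ w x‖ = ‖x‖ := fun w x => by
    have := (φ w).isometry.dist_eq x 0
    rwa [h0, dist_zero_right, dist_zero_right] at this
  have hinv : ∀ w x, φ w (φ w⁻¹ x) = x := fun w x => by
    rw [← IsometryEquiv.mul_apply, ← map_mul, mul_inv_cancel, map_one]
    rfl
  let ρ : ds.involutionSubgroup →* (UnitSphere d ≃ᵢ UnitSphere d) :=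
    { toFun := fun w => IsometryEquiv.mk'
        (fun x => ⟨φ w x, by rw [mem_sphere_zero_iff_norm, hnorm, norm_eq_of_mem_sphere]⟩)
        (fun x => ⟨φ w⁻¹ x, by rw [mem_sphere_zero_iff_norm, hnorm, norm_eq_of_mem_sphere]⟩)
        (fun x => Subtype.ext (hinv w x))
        (Isometry.of_dist_eq fun x y => (φ w).isometry.dist_eq x y)
      map_one' := by
        ext x : 2
        exact congrArg (fun f : EuclideanSpace ℝ (Fin (d + 1)) ≃ᵢ _ => f x) (map_one φ)
      map_mul' := fun w w' => by
        ext x : 2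
        exact congrArg (fun f : EuclideanSpace ℝ (Fin (d + 1)) ≃ᵢ _ => f x) (map_mul φ w w') }
  refine ⟨d, ρ, fun K L _ _ => Set.toFinite _, fun i => ⟨a i, ?_, fun x => hφ' i x⟩⟩
  intro h
  have := ha i i
  rw [h, inner_zero_left, involutionGram_self] at this
  exact zero_ne_one this

/-- With `c = 1` the origin is on the positive side of every wall and at distance 1 from it. Each `w
≠ 1` moves it beyond some wall, so the orbit is 1-separated and meets each grid cell at most once.
-/
theorem isEuclideanCoxeter_of_infinite [DecidableEq V] [Infinite ds.involutionSubgroup] {d : ℕ}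
    {a : {v // M.entry v v = 2} → EucSpace d}
    (ha : ∀ i j, ⟪a i, a j⟫_ℝ = M.involutionGram i j) : IsEuclideanCoxeter ds.involutionGen := by
  obtain ⟨φ, hφ⟩ := ds.exists_affine_action ha 1
  obtain ⟨σ, hσ⟩ := ds.exists_involution_hom (G := ℤˣ) (fun _ => -1) (by simp) (by simp)
  have haa : ∀ i, ⟪a i, a i⟫_ℝ = 1 := fun i => by rw [ha, involutionGram_self]
  have hfar : ∀ w, w ≠ 1 → 1 ≤ ‖φ w 0‖ := by
    intro w hw
    obtain ⟨i, hi⟩ := exists_apply_neg (t := ds.involutionGen)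
      (m := fun i j => M.entry i j) (B := M.involutionGram) (σ := σ)
      (g := fun w i => ⟪a i, φ w 0⟫_ℝ + 1)
      ds.closure_range_involutionGen ds.involutionGen_mul_self hσ (fun i j => M.two_le _ _)
      (fun i j => M.symm _ _) (fun i j k hij hk => ds.altProd_involutionGen hij hk)
      involutionGram_self (fun i j hij => involutionGram_of_ne hij)
      (fun i => by
        rw [map_one]
        change 0 < ⟪a i, 0⟫_ℝ + 1
        rw [inner_zero_right]
        norm_num)
      (fun i w j => by
        rw [map_mul, IsometryEquiv.mul_apply, hφ, affineReflection_eq (haa i), inner_sub_right,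
          inner_smul_right, ha j i, involutionGram_symm j i]
        ring) hw
    have hnorm : ‖a i‖ = 1 := by
      have := haa i
      rw [real_inner_self_eq_norm_sq] at this
      nlinarith [norm_nonneg (a i)]
    have h1 := abs_real_inner_le_norm (a i) (φ w 0)
    rw [hnorm, one_mul] at h1
    have h2 := neg_le_abs ⟪a i, φ w 0⟫_ℝ
    linarith
  have hsep : ∀ w w', dist (φ w 0) (φ w' 0) < 1 → w = w' := by
    intro w w' h
    by_contra hne
    have h1 := hfar (w'⁻¹ * w) (fun h => hne (inv_mul_eq_one.1 h).symm)
    have h2 := (φ w').isometry.dist_eq (φ (w'⁻¹ * w) 0) 0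
    rw [← IsometryEquiv.mul_apply, ← map_mul, mul_inv_cancel_left, dist_zero_right] at h2
    linarith
  refine ⟨inferInstance, d, φ, fun K L hK hL => ?_, fun i => ⟨a i, -(1 : ℝ) • a i, ?_, fun x => ?_⟩⟩
  · obtain ⟨r, hr⟩ := (hK.isBounded.union hL.isBounded).exists_norm_le
    obtain ⟨R, hR⟩ := exists_nat_ge (r + r)
    refine Set.Finite.of_finite_image (f := fun w => gridCell (φ w 0))
      ((Finset.finite_toSet (Fintype.piFinset fun _ : Fin d =>
        Finset.Icc (-(((d + 1) * R : ℕ) : ℤ)) ((d + 1) * R : ℕ))).subset ?_)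
      fun w _ w' _ h => hsep w w' (dist_lt_one_of_gridCell_eq h)
    rintro _ ⟨w, ⟨_, ⟨x, hx, rfl⟩, hxL⟩, rfl⟩
    refine gridCell_mem (le_trans ?_ hR)
    have h1 := hr x (Or.inl hx)
    have h2 := hr _ (Or.inr hxL)
    have h3 := (φ w).isometry.dist_eq 0 x
    rw [dist_zero_left] at h3
    calc ‖φ w 0‖ ≤ ‖φ w x‖ + ‖φ w 0 - φ w x‖ := norm_le_norm_add_norm_sub' _ _
      _ ≤ r + r := by
        rw [← dist_eq_norm, h3]
        exact add_le_add h2 h1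
  · intro h
    have := haa i
    rw [h, inner_zero_left] at this
    exact zero_ne_one this
  · rw [hφ, affineReflection_apply]

end DyerSystem

/-! ### Polynomial growth -/

section Euclidean

variable {ι W : Type*} [Group W] {t : ι → W}

/-- The sphere is compact, so proper discontinuity applies with both compact sets equal to it. -/
theorem finite_of_isSphericalCoxeter (h : IsSphericalCoxeter t) : Finite W := by
  obtain ⟨d, ρ, hρ, -⟩ := h
  have h1 := hρ Set.univ Set.univ isCompact_univ isCompact_univ
  have hne : Nonempty (UnitSphere d) :=
    (NormedSpace.sphere_nonempty (x := (0 : EuclideanSpace ℝ (Fin (d + 1))))).2 zero_le_one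
      |>.to_subtype
  refine Set.finite_univ_iff.1 (h1.subset fun w _ => ?_)
  obtain ⟨x⟩ := hne
  exact ⟨ρ w x, ⟨x, trivial, rfl⟩, trivial⟩

theorem growthFunction_le_of_finite [Finite W] (m : ℕ) : growthFunction t m ≤ Nat.card W := by
  rw [growthFunction, ← Set.ncard_univ]
  exact Set.ncard_le_ncard (Set.subset_univ _)

/-- Elements of the `m`-ball move the origin by at most `R * m`, which leaves `O(m ^ d)` grid cells.
Two elements in one cell differ by an element of the finite set `F` of those moving the origin by at
most 1. -/
theorem growthFunction_le_of_isEuclideanCoxeter [Finite ι] (h : IsEuclideanCoxeter t) :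
    ∃ C k : ℕ, ∀ m, growthFunction t m ≤ C * (m + 1) ^ k := by
  classical
  obtain ⟨-, d, ρ, hρ, -⟩ := h
  have hF := hρ {0} (Metric.closedBall 0 1) isCompact_singleton (isCompact_closedBall 0 1)
  set F := {w : W | ((ρ w '' {0}) ∩ Metric.closedBall 0 1).Nonempty} with hFdef
  have hFmem : ∀ w, ‖ρ w 0‖ ≤ 1 → w ∈ F := fun w hw =>
    ⟨ρ w 0, ⟨0, rfl, rfl⟩, by simpa using hw⟩
  obtain ⟨R, hR⟩ : ∃ R : ℕ, ∀ i, ‖ρ (t i) 0‖ ≤ R := by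
    obtain ⟨r, hr⟩ := (Set.finite_range fun i => ‖ρ (t i) 0‖).bddAbove
    obtain ⟨R, hR⟩ := exists_nat_ge r
    exact ⟨R, fun i => (hr ⟨i, rfl⟩).trans hR⟩
  have hmul : ∀ w x, ‖ρ (w * x) 0‖ ≤ ‖ρ w 0‖ + ‖ρ x 0‖ := by
    intro w x
    have h1 := (ρ w).isometry.dist_eq (ρ x 0) 0
    rw [dist_zero_right] at h1
    rw [map_mul, IsometryEquiv.mul_apply, ← h1, dist_eq_norm]
    exact norm_le_norm_add_norm_sub' _ _
  have hinv : ∀ w, ‖ρ w⁻¹ 0‖ = ‖ρ w 0‖ := by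
    intro w
    have h1 := (ρ w).isometry.dist_eq (ρ w⁻¹ 0) 0
    rw [dist_zero_right, ← IsometryEquiv.mul_apply, ← map_mul, mul_inv_cancel, map_one,
      dist_comm] at h1
    rw [← h1, ← dist_zero_right]
    rfl
  have hball : ∀ m, ∀ w ∈ wordBall t m, ‖ρ w 0‖ ≤ (R * m : ℕ) := by
    intro m w hw
    refine wordBall_induction (P := fun m w => ‖ρ w 0‖ ≤ (R * m : ℕ)) ?_ ?_ ?_ hw
    · intro m
      rw [map_one]
      change ‖(0 : EucSpace d)‖ ≤ _
      rw [norm_zero]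
      positivity
    · intro m i x hx
      have := hmul (t i) x
      have := hR i
      push_cast at hx ⊢
      linarith
    · intro m i x hx
      have := hmul (t i)⁻¹ x
      rw [hinv] at this
      have := hR i
      push_cast at hx ⊢
      linarith
  refine ⟨F.ncard * (2 * ((d + 1) * R) + 1) ^ d, d, fun m => ?_⟩
  have hfin := finite_wordBall t m
  rw [growthFunction, Set.ncard_eq_toFinset_card _ hfin]
  have h1 := Finset.card_le_mul_card_image (f := fun w => gridCell (ρ w 0)) hfin.toFinset F.ncard
    (by
      intro c hc
      obtain ⟨w, -, rfl⟩ := Finset.mem_image.1 hc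
      rw [← Set.ncard_coe_finset, ← Set.ncard_image_of_injective F (mul_right_injective w)]
      refine Set.ncard_le_ncard (fun u hu => ?_) (hF.image _)
      have hu' := (Finset.mem_filter.1 hu).2
      refine ⟨w⁻¹ * u, hFmem _ ?_, mul_inv_cancel_left w u⟩
      have h2 := (ρ w).isometry.dist_eq (ρ (w⁻¹ * u) 0) 0
      rw [← IsometryEquiv.mul_apply, ← map_mul, mul_inv_cancel_left, dist_zero_right] at h2
      rw [← h2]
      exact (dist_lt_one_of_gridCell_eq hu').le)
  refine h1.trans ?_
  rw [mul_assoc, ← mul_pow]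
  refine Nat.mul_le_mul_left _ ?_
  have h3 : hfin.toFinset.image (fun w => gridCell (ρ w 0)) ⊆ Fintype.piFinset fun _ : Fin d =>
      Finset.Icc (-(((d + 1) * (R * m) : ℕ) : ℤ)) ((d + 1) * (R * m) : ℕ) := by
    intro c hc
    obtain ⟨w, hw, rfl⟩ := Finset.mem_image.1 hc
    exact gridCell_mem (hball m w (hfin.mem_toFinset.1 hw))
  refine (Finset.card_le_card h3).trans ?_
  rw [card_gridCells]
  refine Nat.pow_le_pow_left ?_ _
  nlinarith [Nat.zero_le ((d + 1) * R)]

end Euclidean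

/-! ### From the growth of `D_2` to that of `D`, and the dichotomy. -/

namespace DyerSystem

open DyerMatrix
open scoped InnerProductSpace

variable {V : Type*} {M : DyerMatrix V} {D : Type*} [Group D] (ds : DyerSystem M D)

theorem commute_gen_of_not_adj (h : ∀ u v, 3 ≤ M.entry u u → ¬ M.graph.Adj u v) {u : V}
    (hu : 3 ≤ M.entry u u) (v : V) : Commute (ds.gen u) (ds.gen v) := by
  by_cases huv : u = v
  · rw [huv]
  refine ds.gen_mul_gen_of_entry_eq_two huv ?_
  have h1 : ¬ 3 ≤ M.entry u v := fun h3 => h u v hu ⟨huv, h3⟩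
  rcases M.eq_two_or_top u v huv hu with h2 | h2
  · exact h2
  · exact absurd (h2 ▸ le_top) h1

variable [Finite V]

/-- The generators of order at least 3 are central, so an element of the `m`-ball is an element of
the `m`-ball of `D_2` times powers of these generators with exponents in `[-m, m]`. -/
theorem growthFunction_le_of_not_adj (h : ∀ u v, 3 ≤ M.entry u u → ¬ M.graph.Adj u v) :
    ∃ k : ℕ, ∀ m, growthFunction ds.gen m ≤
      growthFunction ds.involutionGen m * (2 * m + 1) ^ k := by
  classical
  have := Fintype.ofFinite {u // 3 ≤ M.entry u u}
  have hcomm : Pairwise fun i j : {u // 3 ≤ M.entry u u} => ∀ x y,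
      Commute (zpowersHom D (ds.gen i) x) (zpowersHom D (ds.gen j) y) := fun i j _ x y =>
    ((ds.commute_gen_of_not_adj h i.2 j).zpow_zpow _ _)
  let Ψ : ({u // 3 ≤ M.entry u u} → Multiplicative ℤ) →* D :=
    MonoidHom.noncommPiCoprod (fun u => zpowersHom D (ds.gen u)) hcomm
  have hΨ : ∀ (u : {u // 3 ≤ M.entry u u}) (n : ℤ),
      Ψ (Pi.mulSingle u (Multiplicative.ofAdd n)) = ds.gen u ^ n := fun u n => by
    rw [MonoidHom.noncommPiCoprod_mulSingle]
    simp
  have hw : ∀ (u : {u // 3 ≤ M.entry u u}) (w : ds.involutionSubgroup),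
      Commute (ds.gen u) (w : D) := by
    intro u w
    have hle : ds.involutionSubgroup ≤ Subgroup.centralizer {ds.gen u} := by
      rw [involutionSubgroup, Subgroup.closure_le]
      rintro _ ⟨v, -, rfl⟩
      rw [SetLike.mem_coe, Subgroup.mem_centralizer_singleton_iff]
      exact (ds.commute_gen_of_not_adj h u.2 v).symm
    exact (Subgroup.mem_centralizer_singleton_iff.1 (hle w.2)).symm
  have key : ∀ m, ∀ x ∈ wordBall ds.gen m, ∃ w ∈ wordBall ds.involutionGen m,
      ∃ e : {u // 3 ≤ M.entry u u} → Multiplicative ℤ,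
        (∀ u, |(e u).toAdd| ≤ m) ∧ x = w * Ψ e := by
    intro m x hx
    have hbig : ∀ (m : ℕ) (u : {u // 3 ≤ M.entry u u}) (n : ℤ) (x : D), |n| ≤ 1 →
        (∃ w ∈ wordBall ds.involutionGen m, ∃ e : {u // 3 ≤ M.entry u u} → Multiplicative ℤ,
          (∀ u, |(e u).toAdd| ≤ m) ∧ x = w * Ψ e) →
        ∃ w ∈ wordBall ds.involutionGen (m + 1),
          ∃ e : {u // 3 ≤ M.entry u u} → Multiplicative ℤ,
            (∀ u, |(e u).toAdd| ≤ (m + 1 : ℕ)) ∧ ds.gen u ^ n * x = w * Ψ e := by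
      rintro m u n x hn ⟨w, hwm, e, he, rfl⟩
      refine ⟨w, wordBall_mono (Nat.le_succ m) hwm,
        Pi.mulSingle u (Multiplicative.ofAdd n) * e, fun u' => ?_, ?_⟩
      · have h1 := he u'
        rw [Pi.mul_apply, toAdd_mul]
        push_cast
        by_cases huu : u' = u
        · subst huu
          rw [Pi.mulSingle_eq_same, toAdd_ofAdd]
          have := abs_add_le n (e u').toAdd
          linarith
        · rw [Pi.mulSingle_eq_of_ne huu, toAdd_one, zero_add]
          linarith
      · rw [map_mul, hΨ, ← mul_assoc, ← mul_assoc, ((hw u w).zpow_left n).eq]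
    refine wordBall_induction (P := fun m x => ∃ w ∈ wordBall ds.involutionGen m,
      ∃ e : {u // 3 ≤ M.entry u u} → Multiplicative ℤ,
        (∀ u, |(e u).toAdd| ≤ m) ∧ x = w * Ψ e) ?_ ?_ ?_ hx
    · exact fun m => ⟨1, one_mem_wordBall m, 1, by simp, by simp⟩
    · intro m v x hx
      by_cases hv : 3 ≤ M.entry v v
      · have := hbig m ⟨v, hv⟩ 1 x (by simp) hx
        rwa [zpow_one] at this
      · obtain ⟨w, hwm, e, he, rfl⟩ := hx
        refine ⟨ds.involutionGen ⟨v, entry_eq_two hv⟩ * w, ?_, e, fun u => ?_, ?_⟩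
        · rw [add_comm]
          exact mul_mem_wordBall (gen_mem_wordBall _) hwm
        · have := he u
          push_cast
          linarith
        · rw [← mul_assoc]
          rfl
    · intro m v x hx
      by_cases hv : 3 ≤ M.entry v v
      · have := hbig m ⟨v, hv⟩ (-1) x (by simp) hx
        rwa [zpow_neg_one] at this
      · obtain ⟨w, hwm, e, he, rfl⟩ := hx
        refine ⟨(ds.involutionGen ⟨v, entry_eq_two hv⟩)⁻¹ * w, ?_, e, fun u => ?_, ?_⟩
        · rw [add_comm]
          exact mul_mem_wordBall (gen_inv_mem_wordBall _) hwm
        · have := he u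
          push_cast
          linarith
        · rw [← mul_assoc]
          rfl
  refine ⟨Fintype.card {u // 3 ≤ M.entry u u}, fun m => ?_⟩
  let P : Finset ({u // 3 ≤ M.entry u u} → ℤ) :=
    Fintype.piFinset fun _ => Finset.Icc (-(m : ℤ)) m
  have hP : (P : Set ({u // 3 ≤ M.entry u u} → ℤ)).ncard =
      (2 * m + 1) ^ Fintype.card {u // 3 ≤ M.entry u u} := by
    rw [Set.ncard_coe_finset, Fintype.card_piFinset, Finset.prod_const, Finset.card_univ,
      Int.card_Icc]
    congr 1
    omega
  have hfin := (finite_wordBall ds.involutionGen m).prod (Finset.finite_toSet P)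
  rw [growthFunction, growthFunction, ← hP, ← Set.ncard_prod]
  refine (Set.ncard_le_ncard (t := (fun p : ds.involutionSubgroup × ({u // 3 ≤ M.entry u u} → ℤ) =>
    (p.1 : D) * Ψ fun u => Multiplicative.ofAdd (p.2 u)) '' (wordBall ds.involutionGen m ×ˢ ↑P))
    (fun x hx => ?_) (hfin.image _)).trans (Set.ncard_image_le hfin)
  obtain ⟨w, hwm, e, he, rfl⟩ := key m x hx
  refine ⟨(w, fun u => (e u).toAdd), ⟨hwm, ?_⟩, rfl⟩
  simp only [P, Finset.mem_coe, Fintype.mem_piFinset, Finset.mem_Icc]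
  exact fun u => abs_le.1 (he u)

theorem growthRate_eq_one_of_not_adj (h : ∀ u v, 3 ≤ M.entry u u → ¬ M.graph.Adj u v)
    {C k : ℕ} (hC : ∀ m, growthFunction ds.involutionGen m ≤ C * (m + 1) ^ k) :
    growthRate ds.gen = 1 := by
  obtain ⟨l, hl⟩ := ds.growthFunction_le_of_not_adj h
  refine growthRate_eq_one_of_polynomial ds.gen (C := C * 2 ^ l) (k := k + l) fun m => ?_
  calc growthFunction ds.gen m ≤ growthFunction ds.involutionGen m * (2 * m + 1) ^ l := hl m
    _ ≤ (C * (m + 1) ^ k) * (2 * (m + 1)) ^ l :=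
        Nat.mul_le_mul (hC m) (Nat.pow_le_pow_left (by omega) _)
    _ = C * 2 ^ l * (m + 1) ^ (k + l) := by rw [mul_pow]; ring

theorem growthRate_eq_one_of_isSpherical (h : ds.IsSpherical) : growthRate ds.gen = 1 := by
  have := finite_of_isSphericalCoxeter h.2
  exact ds.growthRate_eq_one_of_not_adj h.1 (C := Nat.card ds.involutionSubgroup) (k := 0)
    fun m => by simpa using growthFunction_le_of_finite m

theorem growthRate_eq_one_of_isEuclidean (h : ds.IsEuclidean) : growthRate ds.gen = 1 := by
  obtain ⟨C, k, hC⟩ := growthFunction_le_of_isEuclideanCoxeter h.2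
  exact ds.growthRate_eq_one_of_not_adj h.1 hC

theorem isSpherical_or_isEuclidean_of_growthRate_eq_one (h : growthRate ds.gen = 1) :
    ds.IsSpherical ∨ ds.IsEuclidean := by
  classical
  have := Fintype.ofFinite V
  have hadj := ds.not_adj_of_growthRate_eq_one h
  obtain ⟨d, a, ha⟩ := exists_vectors (ds.gramForm_involution_nonneg_of_growthRate_eq_one h)
  cases finite_or_infinite ds.involutionSubgroup
  · exact Or.inl ⟨fun u v hu => hadj u v hu, ds.isSphericalCoxeter_of_finite ha⟩
  · exact Or.inr ⟨fun u v hu => hadj u v hu, ds.isEuclideanCoxeter_of_infinite ha⟩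

end DyerSystem

theorem mainTheorem5 {V : Type*} [Finite V] {M : DyerMatrix V} {D : Type*} [Group D]
    (ds : DyerSystem M D) :
    Tendsto (growthRoot ds.gen) atTop (𝓝 (growthRate ds.gen)) ∧
      (growthRate ds.gen = 1 ↔ ds.IsSpherical ∨ ds.IsEuclidean) :=
  ⟨tendsto_growthRoot ds.gen, ds.isSpherical_or_isEuclidean_of_growthRate_eq_one, fun h =>
    h.elim ds.growthRate_eq_one_of_isSpherical ds.growthRate_eq_one_of_isEuclidean⟩
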